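/- Let $\Bbbk$ be a field of characteristic different from $2$. Superalgebras are super-commutative $\mathbb{Z}_2$-graded $\Bbbk$-algebras $A=A_0\oplus A_1$. Such an $A$ is Noetherian if $A_0$ is a Noetherian ring and $A_1$ is a finitely generated $A_0$-module. If $A$ is a Noetherian superalgebra whose even part has finite Krull dimension $d=\mathrm{Kdim}(A_0)\ge 0$, a system of odd parameters of $A$ is a finite (possibly empty) sequence $y_1,\dots,y_n\in A_1$ such that there is a longest chain $\mathfrak{p}_0\subsetneq\cdots\subsetneq\mathfrak{p}_d$ of prime ideals of $A_0$ with $\mathrm{Ann}_{A_0}(y_1\cdots y_n)\subseteq\mathfrak{p}_0$. Put $\mathrm{Ksdim}(A)=(d,e)$, where $e$ is the length of a longest system of odd parameters of $A$. A superscheme is a topological space $X^e$ with a sheaf $\mathcal{O}_X$ of superalgebras with local stalks that is covered by open subsets $U$ such that $(U,\mathcal{O}_X|_U)$ is isomorphic to some $\mathrm{SSpec}(A)$ (such $U$ are called affine); here $\mathrm{SSpec}(A)$ is the prime spectrum of $A_0$ with the structure sheaf built from the localizations $(A_0\setminus\mathfrak{p})^{-1}A$. It is Noetherian if it is covered by finitely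 many open $U\simeq\mathrm{SSpec}(A)$ with $A$ Noetherian. $X_{res}=(X^e,\mathcal{O}_X/\mathcal{I}_X)$, where $\mathcal{I}_X$ is the ideal sheaf generated by the odd sections, so that $\dim X_{res}$ is the Krull dimension of the space $X^e$. Let $X$ be a Noetherian superscheme over $\Bbbk$ with $\dim X_{res}<\infty$. Then for every nonempty affine open $U\subseteq X$ the superalgebra $\mathcal{O}(U)$ is Noetherian and $\mathrm{Ksdim}(\mathcal{O}(U))$ is a well-defined pair of nonnegative integers. Moreover, the super-dimension $$\mathrm{sdim}(X)=\sup_{U\in\mathcal{S}}\mathrm{Ksdim}(\mathcal{O}(U))$$ is well defined, where $\mathcal{S}$ is a covering of $X$ by nonempty affine open super-subschemes and the supremum is taken in the set of pairs of nonnegative integers with the lexicographic order: this supremum exists and does not depend on the choice of the (finite or infinite) covering $\mathcal{S}$; that is, there is exactly one pair which is the supremum for every such covering. -/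

import Mathlib

open CategoryTheory TopologicalSpace AlgebraicGeometry Opposite

universe w u

/-- A super-commutative superalgebra over a field `k`: a `ℤ/2`-graded `k`-algebra `A = A₀ ⊕ A₁`
such that `a * b = (-1) ^ (|a| |b|) * (b * a)` for all homogeneous `a`, `b`. -/
structure SAlg (k : Type w) [Field k] where
  carrier : Type u
  [ring : Ring carrier]
  [algebra : Algebra k carrier]
  part : ZMod 2 → Submodule k carrier
  [graded : SetLike.GradedMonoid part]
  internal : DirectSum.IsInternal part
  supercomm : ∀ (i j : ZMod 2) (a b : carrier), a ∈ part i → b ∈ part j →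
    a * b = (-1) ^ (i.val * j.val) * (b * a)

namespace SAlg

variable {k : Type w} [Field k]

instance : CoeSort (SAlg.{w, u} k) (Type u) := ⟨SAlg.carrier⟩

instance (A : SAlg.{w, u} k) : Ring A := A.ring

instance (A : SAlg.{w, u} k) : Algebra k A := A.algebra

instance (A : SAlg.{w, u} k) : SetLike.GradedMonoid A.part := A.graded

/-- Superalgebra morphisms: `k`-algebra homomorphisms preserving the parity. -/
@[ext]
structure Hom (A B : SAlg.{w, u} k) where
  hom : A →ₐ[k] B
  map_part : ∀ (i : ZMod 2) (a : A), a ∈ A.part i → hom a ∈ B.part i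

instance : Category (SAlg.{w, u} k) where
  Hom A B := Hom A B
  id A := ⟨AlgHom.id k A, fun _ _ h => h⟩
  comp f g := ⟨g.hom.comp f.hom, fun i _ h => g.map_part i _ (f.map_part i _ h)⟩

/-- The underlying set of a superalgebra, as a functor. -/
def toType : SAlg.{w, u} k ⥤ Type u where
  obj A := A
  map f := TypeCat.ofHom f.hom

theorem comm_of_even (A : SAlg.{w, u} k) {a : A} (ha : a ∈ A.part 0) (b : A) :
    a * b = b * a := by
  have hb : b ∈ A.part 0 ⊔ A.part 1 := by
    have := A.internal.submodule_iSup_eq_top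
    have h2 : (⨆ i, A.part i) ≤ A.part 0 ⊔ A.part 1 := by
      refine iSup_le fun i => ?_
      fin_cases i
      · exact le_sup_left
      · exact le_sup_right
    exact h2 (this ▸ Submodule.mem_top)
  obtain ⟨x, hx, y, hy, rfl⟩ := Submodule.mem_sup.mp hb
  have h0 := A.supercomm 0 0 a x ha hx
  have h1 := A.supercomm 0 1 a y ha hy
  simp only [ZMod.val_zero, zero_mul, pow_zero, one_mul] at h0 h1
  rw [mul_add, add_mul, h0, h1]

/-- The even part `A₀`, a subalgebra of `A`. -/
def even (A : SAlg.{w, u} k) : Subalgebra k A where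
  carrier := A.part 0
  mul_mem' ha hb := by simpa using SetLike.mul_mem_graded (A := A.part) ha hb
  add_mem' ha hb := (A.part 0).add_mem ha hb
  algebraMap_mem' r := by
    rw [Algebra.algebraMap_eq_smul_one]
    exact (A.part 0).smul_mem r (SetLike.one_mem_graded A.part)

theorem mem_even (A : SAlg.{w, u} k) (a : A) : a ∈ A.even ↔ a ∈ A.part 0 := Iff.rfl

instance (A : SAlg.{w, u} k) : CommRing A.even :=
  { A.even.toRing with
    mul_comm := fun a b => Subtype.ext (A.comm_of_even a.2 b.1) }

/-- `A` is an algebra over its even part `A₀`, the action being the multiplication of `A`. -/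
instance (A : SAlg.{w, u} k) : Algebra A.even A where
  algebraMap := A.even.val.toRingHom
  commutes' a b := A.comm_of_even a.2 b
  smul_def' _ _ := rfl

/-- The homogeneous component `A_i`, that is, `A₀` (for `i = 0`) or `A₁` (for `i = 1`), as `A₀`-submodules of `A`. -/
def partSubmodule (A : SAlg.{w, u} k) (i : ZMod 2) : Submodule A.even A where
  carrier := A.part i
  add_mem' ha hb := (A.part i).add_mem ha hb
  zero_mem' := (A.part i).zero_mem
  smul_mem' c x hx := by
    have := SetLike.mul_mem_graded (A := A.part) c.2 hx
    rwa [zero_add] at this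

/-- The even part of a superalgebra, as a functor to commutative rings. -/
def evenFunctor : SAlg.{w, u} k ⥤ CommRingCat.{u} where
  obj A := CommRingCat.of A.even
  map {A B} f := CommRingCat.ofHom
    { toFun := fun a => ⟨f.hom a.1, f.map_part 0 _ a.2⟩
      map_one' := Subtype.ext (map_one f.hom)
      map_mul' := fun a b => Subtype.ext (map_mul f.hom a.1 b.1)
      map_zero' := Subtype.ext (map_zero f.hom)
      map_add' := fun a b => Subtype.ext (map_add f.hom a.1 b.1) }

theorem isCompl_part (A : SAlg.{w, u} k) : IsCompl (A.part 0) (A.part 1) := by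
  refine (DirectSum.isInternal_submodule_iff_isCompl A.part (i := 0) (j := 1) (by decide) ?_).mp
    A.internal
  ext i
  have : ∀ j : ZMod 2, j = 0 ∨ j = 1 := by decide
  simpa using this i

theorem isCompl_partSubmodule (A : SAlg.{w, u} k) :
    IsCompl (A.partSubmodule 0) (A.partSubmodule 1) := by
  refine ⟨Submodule.disjoint_def.mpr fun x h0 h1 =>
    Submodule.disjoint_def.mp A.isCompl_part.disjoint x h0 h1, codisjoint_iff.mpr ?_⟩
  refine eq_top_iff.mpr fun x _ => ?_
  obtain ⟨y, hy, z, hz, h⟩ := Submodule.mem_sup.mp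
    ((codisjoint_iff.mp A.isCompl_part.codisjoint) ▸ Submodule.mem_top : x ∈ A.part 0 ⊔ A.part 1)
  exact Submodule.mem_sup.mpr ⟨y, hy, z, hz, h⟩

/-! ### Noetherian superalgebras and Krull super-dimension -/

/-- `A` is Noetherian: `A₀` is a Noetherian ring and `A₁` is a finitely generated `A₀`-module. -/
def IsNoetherian (A : SAlg.{w, u} k) : Prop :=
  IsNoetherianRing A.even ∧ (A.partSubmodule 1).FG

/-- `y₁, …, yₙ ∈ A₁` is a system of odd parameters: there is a longest prime chain
`𝔭₀ ⊂ ⋯ ⊂ 𝔭_d` in `A₀` (`d` being the Krull dimension of `A₀`) such that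
`Ann_{A₀}(y₁ ⋯ yₙ) ⊆ 𝔭₀`. -/
def IsSystemOfOddParameters (A : SAlg.{w, u} k) {n : ℕ} (y : Fin n → A) : Prop :=
  (∀ i, y i ∈ A.part 1) ∧
    ∃ c : LTSeries (PrimeSpectrum A.even), (c.length : WithBot ℕ∞) = ringKrullDim A.even ∧
      Ideal.torsionOf A.even A (List.ofFn y).prod ≤ c.head.asIdeal

/-- `A.HasKsdim p` says that the Krull super-dimension of `A` is `p = (d, e)`, i.e. the Krull
dimension of `A₀` is the natural number `d`, and `e` is the length of a longest system of odd
parameters of `A`. Pairs of natural numbers carry the lexicographic order. -/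
def HasKsdim (A : SAlg.{w, u} k) (p : ℕ ×ₗ ℕ) : Prop :=
  ringKrullDim A.even = ((ofLex p).1 : WithBot ℕ∞) ∧
    IsGreatest {n : ℕ | ∃ y : Fin n → A, A.IsSystemOfOddParameters y} (ofLex p).2

/-! ### The affine superscheme `SSpec A` -/

/-- The localization `A_𝔓 = (A₀ ∖ 𝔭)⁻¹ A` at a prime `𝔭` of `A₀`, where `𝔓 = 𝔭 ⊕ A₁`. -/
abbrev LocalizedAt (A : SAlg.{w, u} k) (p : PrimeSpectrum A.even) : Type u :=
  LocalizedModule p.asIdeal.primeCompl A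

/-- The sections of the structure sheaf of `SSpec A` over `U`: the functions `s` on `U` with
`s(𝔭) ∈ (A₀ ∖ 𝔭)⁻¹ A` which are locally of the form `a / f` with `a ∈ A`, `f ∈ A₀`. They form a
subalgebra of the product of the localizations. -/
def sectionsSubalgebra (A : SAlg.{w, u} k) (U : Opens (PrimeSpectrum A.even)) :
    Subalgebra A.even (Π x : U, A.LocalizedAt x.1) where
  carrier := {s | ∀ x : U, ∃ (V : Opens (PrimeSpectrum A.even)) (_ : x.1 ∈ V) (i : V ⟶ U)
    (a : A) (f : A.even), ∀ y : V, ∃ hf : f ∉ y.1.asIdeal,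
      s ⟨y.1, i.le y.2⟩ = LocalizedModule.mk a ⟨f, hf⟩}
  add_mem' {a b} ha hb x := by
    obtain ⟨Va, ma, ia, ra, sa, wa⟩ := ha x
    obtain ⟨Vb, mb, ib, rb, sb, wb⟩ := hb x
    refine ⟨Va ⊓ Vb, ⟨ma, mb⟩, homOfLE (inf_le_left.trans ia.le), sb • ra + sa • rb, sa * sb, fun x ↦ ?_⟩
    obtain ⟨hsax, hsa⟩ := wa ⟨x.1, x.2.1⟩
    obtain ⟨hsbx, hsb⟩ := wb ⟨x.1, x.2.2⟩
    exact ⟨fun h => (x.1.isPrime.mem_or_mem h).elim hsax hsbx,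
      congr($hsa + $hsb).trans (LocalizedModule.mk_add_mk ..)⟩
  mul_mem' {a b} ha hb x := by
    obtain ⟨Va, ma, ia, ra, sa, wa⟩ := ha x
    obtain ⟨Vb, mb, ib, rb, sb, wb⟩ := hb x
    refine ⟨Va ⊓ Vb, ⟨ma, mb⟩, homOfLE (inf_le_left.trans ia.le), ra * rb, sa * sb, fun x ↦ ?_⟩
    obtain ⟨hsax, hsa⟩ := wa ⟨x.1, x.2.1⟩
    obtain ⟨hsbx, hsb⟩ := wb ⟨x.1, x.2.2⟩
    exact ⟨fun h => (x.1.isPrime.mem_or_mem h).elim hsax hsbx,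
      congr($hsa * $hsb).trans (LocalizedModule.mk_mul_mk ..)⟩
  algebraMap_mem' r x :=
    ⟨U, x.2, 𝟙 _, algebraMap A.even A r, 1,
      fun y ↦ ⟨(Ideal.ne_top_iff_one _).mp y.1.isPrime.ne_top, rfl⟩⟩

/-- The sections of the structure sheaf of `SSpec A` over `U`. -/
def Sections (A : SAlg.{w, u} k) (U : Opens (PrimeSpectrum A.even)) : Type u :=
  A.sectionsSubalgebra U

noncomputable instance (A : SAlg.{w, u} k) (U : Opens (PrimeSpectrum A.even)) :
    Ring (A.Sections U) :=
  inferInstanceAs (Ring (A.sectionsSubalgebra U))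

noncomputable instance (A : SAlg.{w, u} k) (U : Opens (PrimeSpectrum A.even)) :
    Algebra A.even (A.Sections U) :=
  inferInstanceAs (Algebra A.even (A.sectionsSubalgebra U))

noncomputable instance (A : SAlg.{w, u} k) (U : Opens (PrimeSpectrum A.even)) : Algebra k (A.Sections U) :=
  Algebra.compHom _ (algebraMap k A.even)

/-- The elements `a / f` of `(A₀ ∖ 𝔭)⁻¹ A` with `a ∈ A_i` and `f ∈ A₀ ∖ 𝔭`. -/
def localizedPart (A : SAlg.{w, u} k) (p : PrimeSpectrum A.even) (i : ZMod 2) :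
    Submodule A.even (A.LocalizedAt p) where
  carrier := {s | ∃ a ∈ A.partSubmodule i, ∃ f, s = LocalizedModule.mk a f}
  add_mem' := by
    rintro _ _ ⟨a, ha, f, rfl⟩ ⟨b, hb, g, rfl⟩
    exact ⟨_, (A.partSubmodule i).add_mem ((A.partSubmodule i).smul_mem g.1 ha)
      ((A.partSubmodule i).smul_mem f.1 hb), f * g, LocalizedModule.mk_add_mk⟩
  zero_mem' := ⟨0, (A.partSubmodule i).zero_mem, 1, (LocalizedModule.zero_mk 1).symm⟩
  smul_mem' := by
    rintro c _ ⟨a, ha, f, rfl⟩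
    exact ⟨_, (A.partSubmodule i).smul_mem c ha, f, LocalizedModule.smul'_mk ..⟩

/-- The sections over `U` of parity `i`: those whose value at each point has parity `i`. -/
def sectionsPart (A : SAlg.{w, u} k) (U : Opens (PrimeSpectrum A.even)) (i : ZMod 2) :
    Submodule k (A.Sections U) where
  carrier := {s | ∀ x : U, s.1 x ∈ A.localizedPart x.1 i}
  add_mem' ha hb x := (A.localizedPart x.1 i).add_mem (ha x) (hb x)
  zero_mem' x := (A.localizedPart x.1 i).zero_mem
  smul_mem' c _ hs x := (A.localizedPart x.1 i).smul_mem (algebraMap k A.even c) (hs x)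

theorem one_mem_localizedPart (A : SAlg.{w, u} k) (p : PrimeSpectrum A.even) :
    (1 : A.LocalizedAt p) ∈ A.localizedPart p 0 :=
  ⟨1, SetLike.one_mem_graded A.part, 1, OreLocalization.one_def⟩

theorem mul_mem_localizedPart (A : SAlg.{w, u} k) (p : PrimeSpectrum A.even) (i j : ZMod 2)
    {s t : A.LocalizedAt p} (hs : s ∈ A.localizedPart p i)
    (ht : t ∈ A.localizedPart p j) : s * t ∈ A.localizedPart p (i + j) := by
  obtain ⟨a, ha, f, rfl⟩ := hs
  obtain ⟨b, hb, g, rfl⟩ := ht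
  exact ⟨a * b, SetLike.mul_mem_graded (A := A.part) ha hb, f * g, LocalizedModule.mk_mul_mk⟩

theorem supercomm_localizedPart (A : SAlg.{w, u} k) (p : PrimeSpectrum A.even) (i j : ZMod 2)
    {s t : A.LocalizedAt p} (hs : s ∈ A.localizedPart p i)
    (ht : t ∈ A.localizedPart p j) :
    (Even (i.val * j.val) → s * t = t * s) ∧ (Odd (i.val * j.val) → s * t = -(t * s)) := by
  obtain ⟨a, ha, f, rfl⟩ := hs
  obtain ⟨b, hb, g, rfl⟩ := ht
  have h := A.supercomm i j a b ha hb
  constructor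
  · intro h2
    rw [h2.neg_one_pow, one_mul] at h
    rw [LocalizedModule.mk_mul_mk, LocalizedModule.mk_mul_mk, h, mul_comm g f]
  · intro h2
    rw [h2.neg_one_pow, neg_one_mul] at h
    rw [LocalizedModule.mk_mul_mk, LocalizedModule.mk_mul_mk, h, mul_comm g f,
      LocalizedModule.mk_neg]

theorem disjoint_localizedPart (A : SAlg.{w, u} k) (p : PrimeSpectrum A.even)
    {s : A.LocalizedAt p} (h0 : s ∈ A.localizedPart p 0)
    (h1 : s ∈ A.localizedPart p 1) : s = 0 := by
  obtain ⟨a, ha, f, rfl⟩ := h0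
  obtain ⟨b, hb, g, hg⟩ := h1
  obtain ⟨c, hc⟩ := LocalizedModule.mk_eq.mp hg
  have h2 : c • g • a = 0 := Submodule.disjoint_def.mp A.isCompl_partSubmodule.disjoint _
    ((A.partSubmodule 0).smul_mem c.1 ((A.partSubmodule 0).smul_mem g.1 ha))
    (hc ▸ (A.partSubmodule 1).smul_mem c.1 ((A.partSubmodule 1).smul_mem f.1 hb))
  rw [← LocalizedModule.zero_mk 1, LocalizedModule.mk_eq]
  exact ⟨c * g, by simpa [mul_smul] using h2⟩

theorem mk_add_mk_same (A : SAlg.{w, u} k) (p : PrimeSpectrum A.even) (a b : A)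
    (f : p.asIdeal.primeCompl) : (LocalizedModule.mk a f : A.LocalizedAt p) +
      LocalizedModule.mk b f = LocalizedModule.mk (a + b) f := by
  rw [LocalizedModule.mk_add_mk, ← smul_add]
  exact LocalizedModule.mk_cancel_common_left _ _ _

theorem exists_localizedMap (A : SAlg.{w, u} k) (p : PrimeSpectrum A.even)
    (T : A →ₗ[A.even] A) :
    ∃ F : A.LocalizedAt p → A.LocalizedAt p,
      ∀ a f, F (LocalizedModule.mk a f) = LocalizedModule.mk (T a) f :=
  ⟨IsLocalizedModule.map p.asIdeal.primeCompl (LocalizedModule.mkLinearMap _ A)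
    (LocalizedModule.mkLinearMap _ A) T, fun a f => IsLocalizedModule.map_LocalizedModules _ T a f⟩

theorem exists_sectionsPart (A : SAlg.{w, u} k) (U : Opens (PrimeSpectrum A.even)) (s : A.Sections U) :
    ∃ s₀ ∈ A.sectionsPart U 0, ∃ s₁ ∈ A.sectionsPart U 1, s₀ + s₁ = s := by
  let P := (A.partSubmodule 0).projection (A.partSubmodule 1) A.isCompl_partSubmodule
  let Q := (A.partSubmodule 1).projection (A.partSubmodule 0) A.isCompl_partSubmodule.symm
  have hPQ : ∀ a, P a + Q a = a :=
    Submodule.projection_add_projection_eq_self A.isCompl_partSubmodule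
  have key : ∀ (T : A →ₗ[A.even] A) (i : ZMod 2), (∀ a, T a ∈ A.partSubmodule i) →
      ∃ t ∈ A.sectionsPart U i, ∀ (x : U) (a : A)
        (f : x.1.asIdeal.primeCompl),
        s.1 x = LocalizedModule.mk a f → t.1 x = LocalizedModule.mk (T a) f := by
    intro T i hT
    choose F hF using fun x : U => A.exists_localizedMap x.1 T
    refine ⟨⟨fun x => F x (s.1 x), fun x => ?_⟩, fun x => ?_, fun x a f h => ?_⟩
    · obtain ⟨V, hV, j, a, f, h⟩ := s.2 x
      exact ⟨V, hV, j, T a, f, fun y => ⟨(h y).1,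
        (congrArg (F ⟨y.1, j.le y.2⟩) (h y).2).trans (hF ⟨y.1, j.le y.2⟩ a ⟨f, (h y).1⟩)⟩⟩
    · obtain ⟨V, hV, j, a, f, h⟩ := s.2 x
      exact ⟨T a, hT a, ⟨f, (h ⟨x.1, hV⟩).1⟩,
        (congrArg (F x) (h ⟨x.1, hV⟩).2).trans (hF x a ⟨f, (h ⟨x.1, hV⟩).1⟩)⟩
    · exact (congrArg (F x) h).trans (hF x a f)
  obtain ⟨s₀, h₀, e₀⟩ := key P 0 (Submodule.projection_apply_mem _)
  obtain ⟨s₁, h₁, e₁⟩ := key Q 1 (Submodule.projection_apply_mem _)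
  refine ⟨s₀, h₀, s₁, h₁, Subtype.ext (funext fun x => ?_)⟩
  obtain ⟨V, hV, j, a, f, h⟩ := s.2 x
  have h' := (h ⟨x.1, hV⟩).2
  have hf := (h ⟨x.1, hV⟩).1
  have e := congrArg₂ (· + ·) (e₀ x a ⟨f, hf⟩ h') (e₁ x a ⟨f, hf⟩ h')
  refine (e.trans ?_).trans h'.symm
  rw [A.mk_add_mk_same, hPQ]

theorem graded_sectionsPart (A : SAlg.{w, u} k) (U : Opens (PrimeSpectrum A.even)) :
    SetLike.GradedMonoid (A.sectionsPart U) where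
  one_mem := fun x => A.one_mem_localizedPart x.1
  mul_mem := fun i j _ _ hs ht x => A.mul_mem_localizedPart x.1 i j (hs x) (ht x)

theorem internal_sectionsPart (A : SAlg.{w, u} k) (U : Opens (PrimeSpectrum A.even)) :
    DirectSum.IsInternal (A.sectionsPart U) := by
  refine (DirectSum.isInternal_submodule_iff_isCompl _ (i := 0) (j := 1) (by decide) ?_).mpr ?_
  · ext i
    have : ∀ j : ZMod 2, j = 0 ∨ j = 1 := by decide
    simpa using this i
  · refine ⟨Submodule.disjoint_def.mpr fun s h0 h1 => Subtype.ext (funext fun x =>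
      A.disjoint_localizedPart x.1 (h0 x) (h1 x)), codisjoint_iff.mpr ?_⟩
    refine eq_top_iff.mpr fun s _ => ?_
    obtain ⟨s₀, h₀, s₁, h₁, h⟩ := A.exists_sectionsPart U s
    exact Submodule.mem_sup.mpr ⟨s₀, h₀, s₁, h₁, h⟩

theorem supercomm_sectionsPart (A : SAlg.{w, u} k) (U : Opens (PrimeSpectrum A.even)) (i j : ZMod 2)
    (s t : A.Sections U) (hs : s ∈ A.sectionsPart U i) (ht : t ∈ A.sectionsPart U j) :
    s * t = (-1) ^ (i.val * j.val) * (t * s) := by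
  rcases Nat.even_or_odd (i.val * j.val) with h | h
  · rw [h.neg_one_pow, one_mul]
    exact Subtype.ext (funext fun x => (A.supercomm_localizedPart x.1 i j (hs x) (ht x)).1 h)
  · rw [h.neg_one_pow, neg_one_mul]
    exact Subtype.ext (funext fun x => (A.supercomm_localizedPart x.1 i j (hs x) (ht x)).2 h)

/-- The superalgebra of sections over `U` of the structure sheaf of `SSpec A`. -/
noncomputable def sections (A : SAlg.{w, u} k) (U : Opens (PrimeSpectrum A.even)) : SAlg.{w, u} k where
  carrier := A.Sections U
  part := A.sectionsPart U
  graded := A.graded_sectionsPart U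
  internal := A.internal_sectionsPart U
  supercomm := A.supercomm_sectionsPart U

/-- The structure sheaf of `SSpec A`. The restriction maps are the restrictions of functions. -/
noncomputable def structurePresheaf (A : SAlg.{w, u} k) :
    TopCat.Presheaf (SAlg.{w, u} k) (TopCat.of (PrimeSpectrum A.even)) where
  obj U := A.sections U.unop
  map {U V} i := 
    { hom := 
      { toFun := fun s => ⟨fun x => s.1 ⟨x.1, i.unop.le x.2⟩,
          ((structureSheafInType A.even A).1.map i s).2⟩
        map_one' := rfl
        map_mul' := fun _ _ => rfl
        map_zero' := rfl
        map_add' := fun _ _ => rfl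
        commutes' := fun _ => rfl }
      map_part := fun _ _ hs x => hs ⟨x.1, i.unop.le x.2⟩ }

theorem exists_even_fraction (A : SAlg.{w, u} k) (U : Opens (PrimeSpectrum A.even))
    (s : A.Sections U) (hs : s ∈ A.sectionsPart U 0) (x : U) :
    ∃ (V : Opens (PrimeSpectrum A.even)) (_ : x.1 ∈ V) (i : V ≤ U) (a f : A.even),
      ∀ y : V, ∃ hf : f ∉ y.1.asIdeal,
        s.1 ⟨y.1, i y.2⟩ = LocalizedModule.mk (a : A) ⟨f, hf⟩ := by
  obtain ⟨V, hV, j, r, f, h⟩ := s.2 x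
  obtain ⟨a, ha, b, hb, rfl⟩ := Submodule.mem_sup.mp
    ((codisjoint_iff.mp A.isCompl_partSubmodule.codisjoint) ▸ Submodule.mem_top :
      r ∈ A.partSubmodule 0 ⊔ A.partSubmodule 1)
  refine ⟨V, hV, j.le, ⟨a, ha⟩, f, fun y => ⟨(h y).1, ?_⟩⟩
  obtain ⟨hf, h'⟩ := h y
  have hbz : (LocalizedModule.mk b ⟨f, hf⟩ : A.LocalizedAt y.1) = 0 := by
    refine A.disjoint_localizedPart y.1 ?_ ⟨b, hb, _, rfl⟩
    have := (A.localizedPart y.1 0).add_mem (hs ⟨y.1, j.le y.2⟩)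
      ⟨-a, (A.partSubmodule 0).neg_mem ha, ⟨f, hf⟩, rfl⟩
    rwa [h', A.mk_add_mk_same, add_neg_cancel_comm] at this
  exact h'.trans (by rw [← A.mk_add_mk_same, hbz, add_zero])

/-- The even part of the structure sheaf of `SSpec A`. -/
noncomputable def evenPresheaf (A : SAlg.{w, u} k) :
    TopCat.Presheaf CommRingCat.{u} (TopCat.of (PrimeSpectrum A.even)) :=
  A.structurePresheaf ⋙ evenFunctor

theorem isUnit_germ (A : SAlg.{w, u} k) (x : TopCat.of (PrimeSpectrum A.even))
    (U : Opens (TopCat.of (PrimeSpectrum A.even))) (hx : x ∈ U) (s : (A.sections U).even)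
    (V : Opens (PrimeSpectrum A.even)) (hxV : x ∈ V) (i : V ≤ U) (a f : A.even)
    (h : ∀ y : V, ∃ hf : f ∉ y.1.asIdeal,
      (s.1 : A.Sections U).1 ⟨y.1, i y.2⟩ = LocalizedModule.mk (a : A) ⟨f, hf⟩)
    (ha : a ∉ (x : PrimeSpectrum A.even).asIdeal) :
    IsUnit (A.evenPresheaf.germ U x hx s) := by
  let W : Opens (PrimeSpectrum A.even) := V ⊓ PrimeSpectrum.basicOpen a
  have hxW : x ∈ W := ⟨hxV, ha⟩
  let t : A.Sections W := ⟨fun y => LocalizedModule.mk (f : A) ⟨a, y.2.2⟩,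
    fun y => ⟨W, y.2, 𝟙 _, f, a, fun z => ⟨z.2.2, rfl⟩⟩⟩
  let t' : (A.sections W).even := ⟨t, fun y => ⟨f, f.2, _, rfl⟩⟩
  let iW : W ⟶ U := homOfLE (inf_le_left.trans i)
  let sW : (A.sections W).even := A.evenPresheaf.map iW.op s
  have hst : sW * t' = 1 := by
    refine Subtype.ext (Subtype.ext (funext fun y => ?_))
    obtain ⟨hf, h'⟩ := h ⟨y.1, y.2.1⟩
    change (s.1 : A.Sections U).1 ⟨y.1, _⟩ * LocalizedModule.mk (f : A) ⟨a, y.2.2⟩ = 1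
    rw [h', LocalizedModule.mk_mul_mk]
    refine (LocalizedModule.mk_eq.mpr ⟨1, ?_⟩).trans OreLocalization.one_def.symm
    simp only [one_smul, Submonoid.smul_def]
    change (a : A) * f = ((f * a : A.even) : A) * 1
    rw [mul_one, mul_comm f a]
    rfl
  have hu : IsUnit (A.evenPresheaf.map iW.op s) :=
    IsUnit.of_mul_eq_one t' hst
  have := hu.map (A.evenPresheaf.germ W x hxW).hom
  rwa [show (A.evenPresheaf.germ W x hxW).hom
      (A.evenPresheaf.map iW.op s) =
      A.evenPresheaf.germ U x hx s from
      TopCat.Presheaf.germ_res_apply A.evenPresheaf iW x hxW s] at this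

theorem isLocalRing_stalk (A : SAlg.{w, u} k) (x : TopCat.of (PrimeSpectrum A.even)) :
    IsLocalRing (A.evenPresheaf.stalk x) := by
  have : Nontrivial (A.evenPresheaf.stalk x) := by
    refine ⟨0, 1, fun h => ?_⟩
    let F := A.evenPresheaf
    have h' : F.germ ⊤ x (Opens.mem_top x) (0 : (A.sections ⊤).even) =
        F.germ ⊤ x (Opens.mem_top x) (1 : (A.sections ⊤).even) :=
      (map_zero (F.germ ⊤ x (Opens.mem_top x)).hom).trans
        (h.trans (map_one (F.germ ⊤ x (Opens.mem_top x)).hom).symm)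
    obtain ⟨W, hxW, i, j, e⟩ := F.germ_eq x (Opens.mem_top x) (Opens.mem_top x) _ _ h'
    have e' : (0 : A.LocalizedAt x) = 1 :=
      congrFun (congrArg (fun s : (A.sections W).even => (s.1 : A.Sections W).1) e) ⟨x, hxW⟩
    rw [OreLocalization.one_def, ← LocalizedModule.zero_mk 1] at e'
    obtain ⟨c, hc⟩ := LocalizedModule.mk_eq.mp e'
    have hc0 : (c.1 : A) = 0 := by
      have : c.1 • (1 : A) = 0 := by simpa [Submonoid.smul_def] using hc.symm
      exact (mul_one _).symm.trans this
    have : c.1 = 0 := Subtype.ext hc0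
    exact c.2 (this ▸ Ideal.zero_mem _)
  refine IsLocalRing.of_isUnit_or_isUnit_one_sub_self fun z => ?_
  obtain ⟨U, hx, s, rfl⟩ := TopCat.Presheaf.exists_germ_eq _ z
  obtain ⟨V, hxV, i, a, f, h⟩ :=
    A.exists_even_fraction U (s : (A.sections U).even).1 (s : (A.sections U).even).2 ⟨x, hx⟩
  by_cases ha : a ∈ (x : PrimeSpectrum A.even).asIdeal
  · right
    let s' : (A.sections U).even := s
    let d : (A.sections U).even := 1 - s'
    have h1 := A.isUnit_germ x U hx d V hxV i (f - a) f (fun y => ⟨(h y).1, ?_⟩)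
      fun hfa => (h ⟨x, hxV⟩).1 (by simpa using add_mem hfa ha)
    · have h2 : (A.evenPresheaf.germ U x hx).hom d =
          1 - (A.evenPresheaf.germ U x hx).hom s' := by
        rw [← map_one (A.evenPresheaf.germ U x hx).hom]
        exact map_sub (A.evenPresheaf.germ U x hx).hom 1 s'
      exact h2 ▸ h1
    · obtain ⟨hf, h'⟩ := h y
      have h3 : s'.1 + d.1 = 1 := congrArg Subtype.val (add_sub_cancel s' 1)
      have h4 : (s'.1 : A.Sections U).1 ⟨y.1, i y.2⟩ + (d.1 : A.Sections U).1 ⟨y.1, i y.2⟩ = 1 :=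
        congrArg (fun t : A.Sections U => t.1 ⟨y.1, i y.2⟩) h3
      have h5 : (LocalizedModule.mk (a : A) ⟨f, hf⟩ : A.LocalizedAt y.1) +
          LocalizedModule.mk ((f - a : A.even) : A) ⟨f, hf⟩ = 1 := by
        rw [A.mk_add_mk_same]
        refine (LocalizedModule.mk_eq.mpr ⟨1, ?_⟩).trans OreLocalization.one_def.symm
        simp only [one_smul, Submonoid.smul_def]
        change (a : A) + (f - a) = f * 1
        rw [add_sub_cancel, mul_one]
      exact add_left_cancel (h4.trans (h5.symm.trans (congrArg (· + _) h'.symm)))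
  · exact Or.inl (A.isUnit_germ x U hx s V hxV i a f h ha)

end SAlg

/-- A geometric superspace: a topological space with a sheaf of superalgebras all of whose stalks
are local. The sheaf condition is imposed on the underlying presheaf of sets. A superalgebra is
local if and only if its even part is, and the even part of the stalk is the stalk of the even
part. -/
structure SuperSpace (k : Type w) [Field k] extends
    PresheafedSpace.{u, max (u + 1) w, u} (SAlg.{w, u} k) where
  isSheaf : TopCat.Presheaf.IsSheaf (presheaf ⋙ SAlg.toType)
  isLocalRing_stalk : ∀ x : carrier,
    IsLocalRing (TopCat.Presheaf.stalk (C := CommRingCat.{u}) (presheaf ⋙ SAlg.evenFunctor) x)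

/-- The affine superscheme `SSpec A`. -/
noncomputable def SSpec {k : Type w} [Field k] (A : SAlg.{w, u} k) : SuperSpace.{w, u} k where
  carrier := TopCat.of (PrimeSpectrum A.even)
  presheaf := A.structurePresheaf
  isSheaf := (structureSheafInType A.even A).2
  isLocalRing_stalk := A.isLocalRing_stalk

namespace SuperSpace

variable {k : Type w} [Field k] (X : SuperSpace.{w, u} k)

/-- The superalgebra `𝒪(U)` of sections over an open subset `U`. -/
abbrev sections (U : Opens X.carrier) : SAlg.{w, u} k := X.presheaf.obj (op U)

/-- The open super-subspace `(U, 𝒪_X|_U)` is isomorphic to `SSpec A`. An isomorphism of ringed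
superspaces induces isomorphisms of the stalks, so it is automatically local. -/
def IsoSSpec (U : Opens X.carrier) (A : SAlg.{w, u} k) : Prop :=
  Nonempty (X.toPresheafedSpace.restrict U.isOpenEmbedding ≅ (SSpec A).toPresheafedSpace)

/-- `U` is an affine open super-subspace of `X`. -/
def IsAffineOpen (U : Opens X.carrier) : Prop := ∃ A : SAlg.{w, u} k, X.IsoSSpec U A

/-- `X` is a superscheme: it is covered by affine open super-subspaces. -/
def IsSuperscheme : Prop := ∀ x : X.carrier, ∃ U : Opens X.carrier, x ∈ U ∧ X.IsAffineOpen U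

/-- `X` is a Noetherian superscheme: it is covered by finitely many open super-subspaces
isomorphic to `SSpec A` with `A` a Noetherian superalgebra. -/
def IsNoetherian : Prop :=
  ∃ S : Set (Opens X.carrier), S.Finite ∧ sSup S = ⊤ ∧
    ∀ U ∈ S, ∃ A : SAlg.{w, u} k, A.IsNoetherian ∧ X.IsoSSpec U A

/-- The dimension of the scheme `X_res = (X^e, 𝒪_X / ℐ_X)`, where `ℐ_X` is the ideal sheaf
generated by the odd sections. The underlying space of `X_res` is that of `X`, and the dimension
of a scheme is the Krull dimension of its underlying space. -/
noncomputable def dimRes : WithBot ℕ∞ := topologicalKrullDim X.carrier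

/-- `S` is a covering of `X` by nonempty affine open super-subschemes. -/
def IsAffineCovering (S : Set (Opens X.carrier)) : Prop :=
  sSup S = ⊤ ∧ ∀ U ∈ S, U ≠ ⊥ ∧ X.IsAffineOpen U

/-- `p` is the supremum, in the lexicographic order on pairs of natural numbers, of the Krull
super-dimensions of the superalgebras `𝒪(U)`, where `U` runs over `S`. -/
def IsSdim (S : Set (Opens X.carrier)) (p : ℕ ×ₗ ℕ) : Prop :=
  IsLUB {q : ℕ ×ₗ ℕ | ∃ U ∈ S, (X.sections U).HasKsdim q} p

end SuperSpace

/-! Everything rests on comparing two affine opens `U` ≅ `SSpec A` and `V` ≅ `SSpec B`. Let `y₁, …,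
yₙ` be a system of odd parameters of `A`, with longest chain `𝔭₀ ⊂ ⋯ ⊂ 𝔭_d`, and suppose that the
closed end `𝔭_d` lies in `V`. All the `𝔭ᵢ` are generizations of `𝔭_d`, so the whole chain lies in
`V` and gives a chain of the same length in `B`. On a basic open `D(g)` of `V` around `𝔭_d`
contained in `U`, the `yᵢ` become odd elements `zᵢ` of `B` after multiplication by powers of the
unit `g`. The condition on the annihilator only says that the product has nonzero germ at `𝔭₀`, so
it passes from the `yᵢ` to the `zᵢ` (`Chart.exists_ltSeries`).

Hence either `dim B₀ > d`, or the dimensions agree and the `zᵢ` form a system of odd parameters of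
`B`: `Ksdim A ≤ Ksdim B` in the lexicographic order (`le_of_hasKsdim`). Since every covering has a
member containing `𝔭_d`, any two affine coverings have the same upper bounds
(`IsAffineCovering.isSdim_congr`). A finite covering has finitely many values, hence a supremum,
which then serves for all coverings.

That `Ksdim` exists needs two facts. `𝒪(U)` is Noetherian because this property is local: it passes
to `A_f` and descends from `A_f` with the `f` generating the unit ideal (`IsAway.isNoetherian`,
`isNoetherian_of_span`), and two affine opens share small basic opens (`Chart.exists_basicOpen_eq`).
Systems of odd parameters have bounded length because odd elements square to zero away from
characteristic 2, so long products of them vanish (`exists_forall_prod_eq_zero`). -/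

namespace SAlg

variable {k : Type w} [Field k] {A B C : SAlg.{w, u} k}

/-! ### Localization at an even element, and locality of the Noetherian property. -/

theorem exists_add (A : SAlg.{w, u} k) (a : A) :
    ∃ x ∈ A.part 0, ∃ y ∈ A.part 1, x + y = a :=
  Submodule.mem_sup.mp
    ((codisjoint_iff.mp A.isCompl_part.codisjoint) ▸ Submodule.mem_top : a ∈ A.part 0 ⊔ A.part 1)

theorem eq_zero_of_mem_of_mem {a : A} (h0 : a ∈ A.part 0) (h1 : a ∈ A.part 1) : a = 0 :=
  Submodule.disjoint_def.mp A.isCompl_part.disjoint a h0 h1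

theorem even_mul_mem {a b : A} {i : ZMod 2} (ha : a ∈ A.part 0) (hb : b ∈ A.part i) :
    a * b ∈ A.part i := by
  simpa using SetLike.mul_mem_graded (A := A.part) ha hb

/-- The homomorphism of even parts induced by a morphism of superalgebras. -/
def Hom.even (j : A ⟶ B) : A.even →+* B.even := (evenFunctor.map j).hom

/-- The even part of an inverse is already an inverse, since the odd part contributes only an odd
term to a product equal to `1`. -/
theorem isUnit_even {a : A.even} (h : IsUnit (a : A)) : IsUnit a := by
  obtain ⟨b, hb⟩ := h.exists_right_inv
  obtain ⟨x, hx, y, hy, rfl⟩ := A.exists_add b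
  have h1 : (a : A) * x ∈ A.part 0 := even_mul_mem a.2 hx
  have h2 : (a : A) * y ∈ A.part 1 := even_mul_mem a.2 hy
  have h3 : (a : A) * y ∈ A.part 0 := by
    rw [mul_add] at hb
    rw [eq_sub_of_add_eq' hb]
    exact sub_mem (SetLike.one_mem_graded A.part) h1
  rw [mul_add, eq_zero_of_mem_of_mem h3 h2, add_zero] at hb
  exact IsUnit.of_mul_eq_one ⟨x, hx⟩ (Subtype.ext hb)

/-- The morphism `j : A ⟶ C` is, up to isomorphism, the localization of the superalgebra `A` at
the powers of the even element `f`. -/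
structure IsAway (f : A.even) (j : A ⟶ C) : Prop where
  isUnit : IsUnit (j.hom (f : A))
  exists_eq : ∀ (i : ZMod 2) (s : C), s ∈ C.part i →
    ∃ a ∈ A.part i, ∃ n : ℕ, j.hom a = j.hom (f : A) ^ n * s
  exists_pow_mul_eq_zero : ∀ a : A, j.hom a = 0 → ∃ n : ℕ, (f : A) ^ n * a = 0

theorem isAway_of_iso (e : A ≅ B) : IsAway (1 : A.even) e.hom where
  isUnit := by simp
  exists_eq i s hs := by
    have h : e.hom.hom (e.inv.hom s) = s := congrArg (fun g : B ⟶ B => g.hom s) e.inv_hom_id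
    exact ⟨e.inv.hom s, e.inv.map_part i s hs, 0, by simpa using h⟩
  exists_pow_mul_eq_zero a ha := ⟨0, by
    have h : e.inv.hom (e.hom.hom a) = a := congrArg (fun g : A ⟶ A => g.hom a) e.hom_inv_id
    rw [ha, map_zero] at h
    rw [← h, mul_zero]⟩

namespace IsAway

theorem isLocalization {f : A.even} {j : A ⟶ C} (h : IsAway f j) :
    letI := (Hom.even j).toAlgebra
    IsLocalization.Away f C.even := by
  let := (Hom.even j).toAlgebra
  have hf : IsUnit (Hom.even j f) := isUnit_even h.isUnit
  refine (isLocalization_iff _ _).mpr ⟨?_, fun z => ?_, fun {x y} hxy => ?_⟩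
  · rintro ⟨_, n, rfl⟩
    change IsUnit (Hom.even j (f ^ n))
    rw [map_pow]
    exact hf.pow n
  · obtain ⟨a, ha, n, hn⟩ := h.exists_eq 0 z z.2
    refine ⟨(⟨a, ha⟩, ⟨f ^ n, n, rfl⟩), ?_⟩
    rw [mul_comm]
    refine Subtype.ext (Eq.symm (hn.trans ?_))
    change _ = j.hom ((f ^ n : A.even) : A) * z
    rw [SubmonoidClass.coe_pow, map_pow]
  · have h1 : j.hom ((x : A) - y) = 0 := by
      rw [map_sub, sub_eq_zero]
      exact congrArg Subtype.val hxy
    obtain ⟨n, hn⟩ := h.exists_pow_mul_eq_zero _ h1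
    refine ⟨⟨f ^ n, n, rfl⟩, Subtype.ext ?_⟩
    rw [mul_sub, sub_eq_zero] at hn
    simpa using hn

theorem map_mem_span (j : A ⟶ C) {S : Set A} {x : A} (hx : x ∈ Submodule.span A.even S) :
    j.hom x ∈ Submodule.span C.even (j.hom '' S) := by
  induction hx using Submodule.span_induction with
  | mem x hx => exact Submodule.subset_span ⟨x, hx, rfl⟩
  | zero => rw [map_zero]; exact zero_mem _
  | add x y _ _ hx hy => rw [map_add]; exact add_mem hx hy
  | smul c x _ hx =>
    have : j.hom (c • x) = Hom.even j c • j.hom x := map_mul j.hom (c : A) x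
    rw [this]
    exact Submodule.smul_mem _ _ hx

theorem isNoetherian {f : A.even} {j : A ⟶ C} (h : IsAway f j) (hA : A.IsNoetherian) :
    C.IsNoetherian := by
  let := (Hom.even j).toAlgebra
  have := h.isLocalization
  refine ⟨IsLocalization.isNoetherianRing (Submonoid.powers f) C.even hA.1, ?_⟩
  obtain ⟨S, hS⟩ := hA.2
  classical
  refine ⟨S.image j.hom, le_antisymm ?_ fun s hs => ?_⟩
  · rw [Submodule.span_le]
    intro s hs
    simp only [Finset.coe_image, Set.mem_image] at hs
    obtain ⟨a, ha, rfl⟩ := hs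
    exact j.map_part 1 a (hS ▸ Submodule.subset_span ha : a ∈ A.partSubmodule 1)
  · obtain ⟨a, ha, n, hn⟩ := h.exists_eq 1 s hs
    have h1 := map_mem_span j (hS ▸ ha : a ∈ Submodule.span A.even (S : Set A))
    obtain ⟨g, hg⟩ := (isUnit_even (a := Hom.even j f) h.isUnit).exists_left_inv
    have h2 : g ^ n • j.hom a = s := by
      have hg' : (g : C) * j.hom f = 1 := congrArg Subtype.val hg
      have hc : Commute (g : C) (j.hom f) := C.comm_of_even g.2 _
      change ((g ^ n : C.even) : C) * j.hom a = s
      rw [hn, SubmonoidClass.coe_pow, ← mul_assoc, ← hc.mul_pow, hg', one_pow, one_mul]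
    rw [Finset.coe_image, ← h2]
    exact Submodule.smul_mem _ _ h1

/-- If each `s ∈ S` lifts to the submodule `N` after multiplication by a power of `f`, then so does
each element of the span of `S` over the even part. -/
theorem exists_pow_mul_mem_span {f : A.even} {j : A ⟶ C} (h : IsAway f j) {S : Set C}
    {N : Submodule A.even A} (hN : ∀ s ∈ S, ∃ a ∈ N, ∃ n : ℕ, j.hom a = j.hom (f : A) ^ n * s)
    {s : C} (hs : s ∈ Submodule.span C.even S) :
    ∃ a ∈ N, ∃ n : ℕ, j.hom a = j.hom (f : A) ^ n * s := by
  induction hs using Submodule.span_induction with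
  | mem x hx => exact hN x hx
  | zero => exact ⟨0, zero_mem _, 0, by simp⟩
  | add x y _ _ hx hy =>
    obtain ⟨a, ha, n, hn⟩ := hx
    obtain ⟨b, hb, m, hm⟩ := hy
    refine ⟨f ^ m • a + f ^ n • b, add_mem (N.smul_mem _ ha) (N.smul_mem _ hb), n + m, ?_⟩
    change j.hom (((f ^ m : A.even) : A) * a + ((f ^ n : A.even) : A) * b) = _
    rw [map_add, map_mul, map_mul, SubmonoidClass.coe_pow, SubmonoidClass.coe_pow, map_pow, map_pow,
      hn, hm, ← mul_assoc, ← mul_assoc, ← pow_add, ← pow_add, add_comm m n, mul_add]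
  | smul c x _ hx =>
    obtain ⟨a, ha, n, hn⟩ := hx
    obtain ⟨b, hb, m, hm⟩ := h.exists_eq 0 c c.2
    refine ⟨(⟨b, hb⟩ : A.even) • a, N.smul_mem _ ha, m + n, ?_⟩
    change j.hom (b * a) = _ * (c * x)
    have hc : (c : C) * j.hom (f : A) ^ n = j.hom (f : A) ^ n * c := C.comm_of_even c.2 _
    rw [map_mul, hm, hn, pow_add, mul_assoc, mul_assoc, ← mul_assoc (c : C), hc, mul_assoc]

end IsAway

/-- Finitely many `f` suffice. Numerators of generators of each odd part `(A_f)₁`, taken together,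
generate `A₁`, because membership in a submodule may be tested after multiplication by powers of the
`f`. -/
theorem isNoetherian_of_span {S : Set A.even} (hS : Ideal.span S = ⊤)
    (h : ∀ f ∈ S, ∃ (C : SAlg.{w, u} k) (j : A ⟶ C), IsAway f j ∧ C.IsNoetherian) :
    A.IsNoetherian := by
  obtain ⟨T, hTS, hT⟩ := (Ideal.span_eq_top_iff_finite S).mp hS
  choose C j hj hC using h
  refine ⟨isNoetherianRing_of_away T hT fun f => ?_, ?_⟩
  · have hf := hTS f.2
    let := (Hom.even (j f hf)).toAlgebra
    have := (hj f hf).isLocalization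
    have := (hC f hf).1
    exact isNoetherianRing_of_ringEquiv (C f hf).even
      (IsLocalization.algEquiv (Submonoid.powers f.1) (C f hf).even
        (Localization.Away f.1)).toRingEquiv
  · have key : ∀ f ∈ T, ∃ G : Finset A, (G : Set A) ⊆ A.partSubmodule 1 ∧
        ∀ x ∈ A.partSubmodule 1, ∃ n : ℕ, f ^ n • x ∈ Submodule.span A.even (G : Set A) := by
      intro f hf
      have hj := hj f (hTS hf)
      obtain ⟨G, hG⟩ := (hC f (hTS hf)).2
      have hG1 : ∀ s ∈ G, s ∈ (C f (hTS hf)).part 1 := fun s hs =>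
        (hG ▸ Submodule.subset_span hs : s ∈ (C f (hTS hf)).partSubmodule 1)
      choose! a ha n hn using fun s (hs : s ∈ G) => hj.exists_eq 1 s (hG1 s hs)
      classical
      refine ⟨G.image a, ?_, fun x hx => ?_⟩
      · intro y hy
        simp only [Finset.coe_image, Set.mem_image] at hy
        obtain ⟨s, hs, rfl⟩ := hy
        exact ha s hs
      · obtain ⟨b, hb, m, hm⟩ := hj.exists_pow_mul_mem_span (S := (G : Set (C f (hTS hf))))
          (N := Submodule.span A.even (G.image a : Set A))
          (fun s hs => ⟨a s, Submodule.subset_span (by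
            simpa using ⟨s, hs, rfl⟩), n s, hn s hs⟩)
          (s := (j f (hTS hf)).hom x) (hG.symm ▸ (j f (hTS hf)).map_part 1 x hx)
        -- `b` and `f ^ m * x` agree only in the localization; a further power of `f` makes them
        -- agree in `A`.
        obtain ⟨l, hl⟩ := hj.exists_pow_mul_eq_zero (b - (f : A) ^ m * x)
          (by rw [map_sub, map_mul, map_pow, hm, sub_self])
        refine ⟨l + m, ?_⟩
        have : f ^ (l + m) • x = f ^ l • b := by
          change ((f ^ (l + m) : A.even) : A) * x = ((f ^ l : A.even) : A) * b
          rw [mul_sub, sub_eq_zero] at hl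
          rw [SubmonoidClass.coe_pow, SubmonoidClass.coe_pow, hl, pow_add, mul_assoc]
        rw [this]
        exact Submodule.smul_mem _ _ hb
    choose! G hG1 hG using key
    classical
    refine ⟨T.biUnion G, le_antisymm ?_ fun x hx => ?_⟩
    · rw [Submodule.span_le]
      intro y hy
      simp only [Finset.coe_biUnion, Set.mem_iUnion] at hy
      obtain ⟨f, hf, hy⟩ := hy
      exact hG1 f hf hy
    · refine Submodule.mem_of_span_eq_top_of_smul_pow_mem _ _ hT x fun f => ?_
      obtain ⟨n, hn⟩ := hG f.1 f.2 x hx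
      exact ⟨n, Submodule.span_mono (Finset.coe_subset.mpr (Finset.subset_biUnion_of_mem G f.2)) hn⟩

end SAlg

/-! ### Products of odd elements and existence of the Krull super-dimension. -/

namespace SAlg

variable {k : Type w} [Field k] {A B : SAlg.{w, u} k}

theorem odd_mul_odd {a b : A} (ha : a ∈ A.part 1) (hb : b ∈ A.part 1) : a * b = -(b * a) := by
  have := A.supercomm 1 1 a b ha hb
  rwa [show (1 : ZMod 2).val * (1 : ZMod 2).val = 1 from rfl, pow_one, neg_one_mul] at this

theorem odd_mul_self (hk : ringChar k ≠ 2) {a : A} (ha : a ∈ A.part 1) : a * a = 0 := by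
  have h2 : (2 : k) • (a * a) = 0 := by
    rw [two_smul]
    nth_rw 1 [odd_mul_odd ha ha]
    exact neg_add_cancel _
  exact (smul_eq_zero_iff_right (Ring.two_ne_zero hk)).mp h2

theorem odd_mul_prod_eq_zero (hk : ringChar k ≠ 2) {x : A} {l : List A}
    (hl : ∀ y ∈ l, y ∈ A.part 1) (hx : x ∈ l) : x * l.prod = 0 := by
  have hx1 := hl x hx
  induction l with
  | nil => simp at hx
  | cons y t ih =>
    rw [List.prod_cons, ← mul_assoc]
    rcases List.mem_cons.mp hx with rfl | h
    · rw [odd_mul_self hk hx1, zero_mul]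
    · rw [odd_mul_odd hx1 (hl y List.mem_cons_self), neg_mul, mul_assoc,
        ih (fun z hz => hl z (List.mem_cons_of_mem y hz)) h, mul_zero, neg_zero]

theorem prod_eq_zero_of_not_nodup (hk : ringChar k ≠ 2) {l : List A}
    (hl : ∀ y ∈ l, y ∈ A.part 1) (h : ¬ l.Nodup) : l.prod = 0 := by
  induction l with
  | nil => simp at h
  | cons y t ih =>
    have ht : ∀ z ∈ t, z ∈ A.part 1 := fun z hz => hl z (List.mem_cons_of_mem y hz)
    rw [List.prod_cons]
    by_cases hy : y ∈ t
    · exact odd_mul_prod_eq_zero hk ht hy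
    · rw [ih ht fun h' => h (List.nodup_cons.mpr ⟨hy, h'⟩), mul_zero]

open scoped Pointwise in
/-- In a superalgebra with finitely generated odd part, long products of odd elements vanish. -/
theorem exists_forall_prod_eq_zero (hk : ringChar k ≠ 2) (hA : (A.partSubmodule 1).FG) :
    ∃ m : ℕ, ∀ (n : ℕ) (y : Fin n → A), m < n → (∀ i, y i ∈ A.part 1) →
      (List.ofFn y).prod = 0 := by
  obtain ⟨G, hG⟩ := hA
  refine ⟨G.card, fun n y hn hy => ?_⟩
  have h1 : ∀ l : List A, (∀ x ∈ l, x ∈ A.part 1) → l.prod ∈ A.partSubmodule 1 ^ l.length := by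
    intro l hl
    induction l with
    | nil => simp
    | cons x t ih =>
      rw [List.prod_cons, List.length_cons, pow_succ']
      exact Submodule.mul_mem_mul (hl x List.mem_cons_self)
        (ih fun z hz => hl z (List.mem_cons_of_mem x hz))
  have h2 := h1 (List.ofFn y) (by simpa using hy)
  rw [List.length_ofFn, ← hG, Submodule.span_pow] at h2
  -- `A₁ ^ n` is spanned by words of length `n` in the generators; when `n` exceeds their number,
  -- some generator repeats and the word vanishes.
  have h3 : (G : Set A) ^ n ⊆ ({0} : Set A) := by
    intro z hz
    obtain ⟨g, rfl⟩ := Set.mem_pow.mp hz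
    refine prod_eq_zero_of_not_nodup hk (fun x hx => ?_) fun hnd => ?_
    · obtain ⟨i, rfl⟩ := (List.mem_ofFn' _ _).mp hx
      exact (hG ▸ Submodule.subset_span (g i).2 : (g i : A) ∈ A.partSubmodule 1)
    · have hinj : Function.Injective g := fun i j hij =>
        List.nodup_ofFn.mp hnd (congrArg Subtype.val hij)
      have := Fintype.card_le_of_injective g hinj
      simp at this
      omega
  simpa using Submodule.span_mono h3 h2

theorem exists_ltSeries_length_eq {d : ℕ} (h : ringKrullDim A.even = d) :
    ∃ c : LTSeries (PrimeSpectrum A.even), (c.length : WithBot ℕ∞) = ringKrullDim A.even := by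
  obtain ⟨c, hc⟩ := Order.le_krullDim_iff.mp h.ge
  exact ⟨c, by rw [hc, h]⟩

theorem HasKsdim.unique {p q : ℕ ×ₗ ℕ} (hp : A.HasKsdim p) (hq : A.HasKsdim q) : p = q := by
  have h1 : (ofLex p).1 = (ofLex q).1 := by exact_mod_cast hp.1.symm.trans hq.1
  exact ofLex.injective (Prod.ext h1 (hp.2.unique hq.2))

/-- The empty sequence is always a system of odd parameters, as `Ann(1) = 0`. A sequence with zero
product never is one, as its annihilator is all of `A₀`; this bounds the lengths. -/
theorem exists_hasKsdim (hk : ringChar k ≠ 2) (hA : A.IsNoetherian) {d : ℕ}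
    (hd : ringKrullDim A.even = d) : ∃ q, A.HasKsdim q := by
  let s := {n : ℕ | ∃ y : Fin n → A, A.IsSystemOfOddParameters y}
  have hne : s.Nonempty := by
    obtain ⟨c, hc⟩ := exists_ltSeries_length_eq hd
    refine ⟨0, ![], nofun, c, hc, fun a ha => ?_⟩
    have h : (a : A) * 1 = 0 := (Ideal.mem_torsionOf_iff _ _).mp ha
    rw [mul_one] at h
    rw [show a = 0 from Subtype.ext h]
    exact zero_mem _
  have hbdd : BddAbove s := by
    obtain ⟨m, hm⟩ := exists_forall_prod_eq_zero hk hA.2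
    refine ⟨m, ?_⟩
    rintro n ⟨y, hy, c, -, hc⟩
    by_contra! hn
    refine c.head.isPrime.ne_top (top_le_iff.mp fun a _ => hc ?_)
    rw [hm n y hn hy]
    exact (Ideal.mem_torsionOf_iff _ _).mpr (smul_zero a)
  exact ⟨toLex (d, sSup s), hd, Nat.sSup_mem hne hbdd, fun _ h => le_csSup hbdd h⟩

theorem HasKsdim.of_iso (e : A ≅ B) {q : ℕ ×ₗ ℕ} (h : A.HasKsdim q) : B.HasKsdim q := by
  have key : ∀ {A B : SAlg.{w, u} k} (e : A ≅ B) {n : ℕ} {y : Fin n → A},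
      A.IsSystemOfOddParameters y → B.IsSystemOfOddParameters fun i => e.hom.hom (y i) := by
    intro A B e n y ⟨hy, c, hc, hAnn⟩
    let r : A.even ≃+* B.even := (evenFunctor.mapIso e).commRingCatIsoToRingEquiv
    let o : PrimeSpectrum A.even ≃o PrimeSpectrum B.even := PrimeSpectrum.comapEquiv r
    refine ⟨fun i => e.hom.map_part 1 _ (hy i), c.map o o.strictMono, ?_, fun b hb => ?_⟩
    · rw [← ringKrullDim_eq_of_ringEquiv r]
      exact hc
    · change r.symm b ∈ c.head.asIdeal
      refine hAnn ((Ideal.mem_torsionOf_iff _ _).mpr ?_)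
      have h1 := (Ideal.mem_torsionOf_iff _ _).mp hb
      have h2 : (b : B) * e.hom.hom (List.ofFn y).prod = 0 := by
        rw [map_list_prod, List.map_ofFn]
        exact h1
      have h3 := congrArg e.inv.hom h2
      rw [map_mul, map_zero] at h3
      have h4 : e.inv.hom (e.hom.hom (List.ofFn y).prod) = (List.ofFn y).prod :=
        congrArg (fun g : A ⟶ A => g.hom (List.ofFn y).prod) e.hom_inv_id
      rwa [h4] at h3
  let r : A.even ≃+* B.even := (evenFunctor.mapIso e).commRingCatIsoToRingEquiv
  refine ⟨(ringKrullDim_eq_of_ringEquiv r).symm.trans h.1, ?_⟩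
  have : {n : ℕ | ∃ y : Fin n → B, B.IsSystemOfOddParameters y} =
      {n : ℕ | ∃ y : Fin n → A, A.IsSystemOfOddParameters y} :=
    Set.ext fun n => ⟨fun ⟨y, hy⟩ => ⟨_, key e.symm hy⟩, fun ⟨y, hy⟩ => ⟨_, key e hy⟩⟩
  rw [this]
  exact h.2

end SAlg

/-! ### Sections of the structure sheaf of `SSpec A`. -/

namespace SAlg

variable {k : Type w} [Field k] {A : SAlg.{w, u} k}

/-- An element of `A` as a section over `W` of the structure sheaf of `SSpec A`. -/
noncomputable def toOpen (A : SAlg.{w, u} k) (W : Opens (PrimeSpectrum A.even)) :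
    A ⟶ A.sections W where
  hom :=
    { toFun := fun a => (⟨fun _ => LocalizedModule.mk a 1, fun x => ⟨W, x.2, 𝟙 _, a, 1, fun y =>
        ⟨(Ideal.ne_top_iff_one _).mp y.1.isPrime.ne_top, rfl⟩⟩⟩ : A.Sections W)
      map_one' := Subtype.ext (funext fun _ => OreLocalization.one_def.symm)
      map_mul' := fun a b => Subtype.ext (funext fun _ => by
        refine Eq.trans ?_ LocalizedModule.mk_mul_mk.symm
        rw [one_mul])
      map_zero' := Subtype.ext (funext fun _ => LocalizedModule.zero_mk 1)
      map_add' := fun a b => Subtype.ext (funext fun x => (A.mk_add_mk_same x.1 a b 1).symm)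
      commutes' := fun c => rfl }
  map_part i a ha := fun _ => ⟨a, ha, 1, rfl⟩

theorem mk_one_eq_zero {p : PrimeSpectrum A.even} {a : A} :
    (LocalizedModule.mk a 1 : A.LocalizedAt p) = 0 ↔ ∃ c : A.even, c ∉ p.asIdeal ∧ (c : A) * a = 0 := by
  rw [← LocalizedModule.zero_mk 1, LocalizedModule.mk_eq]
  constructor
  · rintro ⟨c, hc⟩
    exact ⟨c.1, c.2, by
      simp only [one_smul, smul_zero] at hc
      exact hc⟩
  · rintro ⟨c, hc, h⟩
    exact ⟨⟨c, hc⟩, by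
      simp only [one_smul, smul_zero]
      exact h⟩

theorem exists_add_of_parity (i : ZMod 2) (a : A) :
    ∃ x ∈ A.part i, ∃ y ∈ A.part (i + 1), x + y = a := by
  obtain ⟨x, hx, y, hy, h⟩ := A.exists_add a
  have : i = 0 ∨ i = 1 := by clear * -; revert i; decide
  rcases this with rfl | rfl
  · exact ⟨x, hx, y, hy, h⟩
  · exact ⟨y, hy, x, hx, (add_comm y x).trans h⟩

theorem eq_zero_of_mem_of_mem_add_one {i : ZMod 2} {a : A} (h : a ∈ A.part i)
    (h' : a ∈ A.part (i + 1)) : a = 0 := by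
  have : i = 0 ∨ i = 1 := by clear * -; revert i; decide
  rcases this with rfl | rfl
  · exact eq_zero_of_mem_of_mem h h'
  · exact eq_zero_of_mem_of_mem h' h

theorem notMem_of_isUnit_toOpen {W : Opens (PrimeSpectrum A.even)} {f : A.even}
    (h : IsUnit ((A.toOpen W).hom (f : A))) {p : PrimeSpectrum A.even} (hp : p ∈ W) :
    f ∉ p.asIdeal := by
  intro hf
  obtain ⟨t, ht⟩ := h.exists_right_inv
  obtain ⟨V, hV, i, b, g, hb⟩ := (t : A.Sections W).2 ⟨p, hp⟩
  obtain ⟨hg, hb⟩ := hb ⟨p, hV⟩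
  have h1 : (LocalizedModule.mk (f : A) 1 : A.LocalizedAt p) * (t : A.Sections W).1 ⟨p, hp⟩ = 1 :=
    congrArg (fun s : A.Sections W => s.1 ⟨p, hp⟩) ht
  have h2 : (LocalizedModule.mk (f : A) 1 : A.LocalizedAt p) * LocalizedModule.mk b ⟨g, hg⟩ = 1 :=
    (congrArg (_ * ·) hb).symm.trans h1
  rw [LocalizedModule.mk_mul_mk, OreLocalization.one_def] at h2
  obtain ⟨c, hc⟩ := LocalizedModule.mk_eq.mp h2
  have hc' : (c.1 : A) * (f * b) = c.1 * g := by
    have : (c.1 : A) * (1 * (f * b)) = c.1 * (((1 * ⟨g, hg⟩ : p.asIdeal.primeCompl).1 : A) * 1) := hc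
    simpa using this
  obtain ⟨x, hx, y, hy, rfl⟩ := A.exists_add b
  have h3 : (c.1 : A) * (f * y) = c.1 * g - c.1 * (f * x) := by
    rw [← hc', mul_add, mul_add, add_sub_cancel_left]
  have h4 : (c.1 : A) * (f * y) ∈ A.part 1 := even_mul_mem c.1.2 (even_mul_mem f.2 hy)
  have h5 : (c.1 : A) * (f * y) ∈ A.part 0 := by
    rw [h3]
    exact sub_mem (even_mul_mem c.1.2 g.2) (even_mul_mem c.1.2 (even_mul_mem f.2 hx))
  rw [eq_zero_of_mem_of_mem h5 h4, eq_comm, sub_eq_zero] at h3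
  -- With the odd part of the inverse discarded, the equation lives in `A₀`, where the primality of
  -- `p` applies.
  have h6 : c.1 * g = c.1 * (f * ⟨x, hx⟩) := Subtype.ext h3
  have h7 : c.1 * g ∈ p.asIdeal := by
    rw [h6]
    exact Ideal.mul_mem_left _ _ (Ideal.mul_mem_right _ _ hf)
  exact (p.isPrime.mem_or_mem h7).elim c.2 hg

/-- As a sheaf of `A₀`-modules, the structure sheaf of `SSpec A` is the sheaf associated with the
module `A`, so the module result on basic opens applies. Only invertibility of `f` and parity remain
to be checked. -/
theorem isAway_toOpen (f : A.even) : IsAway f (A.toOpen (PrimeSpectrum.basicOpen f)) where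
  isUnit := by
    let W := PrimeSpectrum.basicOpen f
    let t : A.Sections W := ⟨fun x => LocalizedModule.mk 1 ⟨f, x.2⟩, fun x =>
      ⟨W, x.2, 𝟙 _, 1, f, fun y => ⟨y.2, rfl⟩⟩⟩
    have key : ∀ x : W, (LocalizedModule.mk (f : A) ⟨f, x.2⟩ : A.LocalizedAt x.1) = 1 := fun x => by
      rw [OreLocalization.one_def]
      refine LocalizedModule.mk_eq.mpr ⟨1, ?_⟩
      change (1 : A) * (1 * f) = 1 * (f * 1)
      simp
    refine isUnit_iff_exists.mpr ⟨t, Subtype.ext (funext fun x => ?_),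
      Subtype.ext (funext fun x => ?_)⟩
    · refine Eq.trans (LocalizedModule.mk_mul_mk (s₁ := 1)) (Eq.trans ?_ (key x))
      rw [mul_one, one_mul]
    · refine Eq.trans (LocalizedModule.mk_mul_mk (s₂ := 1)) (Eq.trans ?_ (key x))
      rw [mul_one, one_mul]
  exists_eq i s hs := by
    let W := PrimeSpectrum.basicOpen f
    obtain ⟨⟨a, ⟨_, n, rfl⟩⟩, ha⟩ := IsLocalizedModule.surj (Submonoid.powers f)
      (StructureSheaf.toOpenₗ A.even A W) s
    have h1 : (A.toOpen W).hom a = (A.toOpen W).hom (f : A) ^ n * s := by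
      rw [← map_pow]
      refine ha.symm.trans (Subtype.ext (funext fun x => ?_))
      exact Algebra.smul_def (f ^ n) ((s : A.Sections W).1 x : A.LocalizedAt x.1)
    obtain ⟨x, hx, y, hy, rfl⟩ := exists_add_of_parity i a
    refine ⟨x, hx, n, ?_⟩
    have h2 : (A.toOpen W).hom y = (A.toOpen W).hom (f : A) ^ n * s - (A.toOpen W).hom x := by
      rw [← h1, map_add, add_sub_cancel_left]
    have h3 : (A.toOpen W).hom y ∈ (A.sections W).part i := by
      rw [h2, ← map_pow]
      refine sub_mem (even_mul_mem ((A.toOpen W).map_part 0 _ ?_) hs) ((A.toOpen W).map_part i x hx)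
      exact (f ^ n : A.even).2
    -- The component `y` of the wrong parity has an image of both parities, hence zero, so the
    -- numerator can be taken homogeneous.
    rw [← h1, map_add, eq_zero_of_mem_of_mem_add_one h3 ((A.toOpen W).map_part _ y hy), add_zero]
  exists_pow_mul_eq_zero a ha := by
    obtain ⟨⟨_, n, rfl⟩, ha⟩ := (IsLocalizedModule.eq_zero_iff (Submonoid.powers f)
      (StructureSheaf.toOpenₗ A.even A (PrimeSpectrum.basicOpen f))).mp ha
    exact ⟨n, ha⟩

end SAlg

/-! ### Charts: transport of points, opens and sections between `X` and `SSpec A`. -/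

namespace SuperSpace

variable {k : Type w} [Field k] {X : SuperSpace.{w, u} k} {U : Opens X.carrier}
  {A : SAlg.{w, u} k}

/-- The restriction of sections to a smaller open subset. -/
def res {V W : Opens X.carrier} (h : V ≤ W) : X.sections W ⟶ X.sections V :=
  X.presheaf.map (homOfLE h).op

theorem res_res {V W Z : Opens X.carrier} (h : V ≤ W) (h' : W ≤ Z) (s : X.sections Z) :
    (X.res h).hom ((X.res h').hom s) = (X.res (h.trans h')).hom s :=
  congrArg (fun g : X.sections Z ⟶ X.sections V => g.hom s)
    (X.presheaf.map_comp (homOfLE h').op (homOfLE h).op).symm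

/-- An isomorphism of the open super-subspace `U` with `SSpec A`. -/
abbrev Chart (X : SuperSpace.{w, u} k) (U : Opens X.carrier) (A : SAlg.{w, u} k) :=
  X.toPresheafedSpace.restrict U.isOpenEmbedding ≅ (SSpec A).toPresheafedSpace

namespace Chart

variable (φ : Chart X U A)

/-- The homeomorphism of `U` with the prime spectrum of the even part underlying a chart. -/
noncomputable def pt : U ≃ₜ PrimeSpectrum A.even :=
  TopCat.homeoOfIso ((PresheafedSpace.forget _).mapIso φ)

/-- The open subset of `X` corresponding to an open subset of `SSpec A`. -/
noncomputable def opens (W : Opens (PrimeSpectrum A.even)) : Opens X.carrier :=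
  U.isOpenEmbedding.functor.obj ((Opens.map φ.hom.base).obj W)

theorem mem_opens {W : Opens (PrimeSpectrum A.even)} {x : X.carrier} :
    x ∈ φ.opens W ↔ ∃ h : x ∈ U, φ.pt ⟨x, h⟩ ∈ W :=
  ⟨fun ⟨y, hy, h⟩ => h ▸ ⟨y.2, hy⟩, fun ⟨h, hx⟩ => ⟨⟨x, h⟩, hx, rfl⟩⟩

theorem opens_mono {V W : Opens (PrimeSpectrum A.even)} (h : V ≤ W) : φ.opens V ≤ φ.opens W :=
  fun _ hx => φ.mem_opens.mpr ⟨(φ.mem_opens.mp hx).1, h (φ.mem_opens.mp hx).2⟩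

theorem opens_le (W : Opens (PrimeSpectrum A.even)) : φ.opens W ≤ U :=
  fun _ hx => (φ.mem_opens.mp hx).1

theorem opens_top : φ.opens ⊤ = U :=
  le_antisymm (φ.opens_le ⊤) fun _ hx => φ.mem_opens.mpr ⟨hx, trivial⟩

/-- The isomorphism of superalgebras of sections given by a chart. -/
noncomputable def sectionsIso (W : Opens (PrimeSpectrum A.even)) :
    A.sections W ≅ X.sections (φ.opens W) :=
  (PresheafedSpace.sheafIsoOfIso φ).app (op W)

theorem res_sectionsIso {V W : Opens (PrimeSpectrum A.even)} (h : V ≤ W) (s : A.sections W) :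
    (X.res (φ.opens_mono h)).hom ((φ.sectionsIso W).hom.hom s) =
      (φ.sectionsIso V).hom.hom ((A.structurePresheaf.map (homOfLE h).op).hom s) :=
  congrArg (fun g : A.sections W ⟶ X.sections (φ.opens V) => g.hom s)
    ((PresheafedSpace.sheafIsoOfIso φ).hom.naturality (homOfLE h).op).symm

/-- An element of `A` as a section over an open subset of the chart. -/
noncomputable def toSections (W : Opens (PrimeSpectrum A.even)) : A ⟶ X.sections (φ.opens W) :=
  A.toOpen W ≫ (φ.sectionsIso W).hom

theorem res_toSections {V W : Opens (PrimeSpectrum A.even)} (h : V ≤ W) (a : A) :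
    (X.res (φ.opens_mono h)).hom ((φ.toSections W).hom a) = (φ.toSections V).hom a :=
  φ.res_sectionsIso h _

end Chart

end SuperSpace

namespace SAlg

variable {k : Type w} [Field k] {A B C : SAlg.{w, u} k}

theorem IsAway.comp_iso {f : A.even} {j : A ⟶ B} (h : IsAway f j) (e : B ≅ C) :
    IsAway f (j ≫ e.hom) where
  isUnit := h.isUnit.map e.hom.hom
  exists_eq i s hs := by
    obtain ⟨a, ha, n, hn⟩ := h.exists_eq i _ (e.inv.map_part i s hs)
    refine ⟨a, ha, n, ?_⟩
    have h1 : e.hom.hom (e.inv.hom s) = s := congrArg (fun g : C ⟶ C => g.hom s) e.inv_hom_id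
    change e.hom.hom (j.hom a) = e.hom.hom (j.hom (f : A)) ^ n * s
    rw [hn, map_mul, map_pow, h1]
  exists_pow_mul_eq_zero a ha := by
    refine h.exists_pow_mul_eq_zero a ?_
    have h1 : e.inv.hom (e.hom.hom (j.hom a)) = j.hom a :=
      congrArg (fun g : B ⟶ B => g.hom (j.hom a)) e.hom_inv_id
    rw [← h1]
    exact (congrArg e.inv.hom ha).trans (map_zero _)

/-- A bijective morphism of superalgebras is an isomorphism. -/
noncomputable def isoOfBijective (j : A ⟶ B) (hj : Function.Bijective j.hom) : A ≅ B where
  hom := j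
  inv :=
    { hom := ((AlgEquiv.ofBijective j.hom hj).symm : B →ₐ[k] A)
      map_part := fun i s hs => by
        obtain ⟨a, rfl⟩ := hj.2 s
        have h1 : (AlgEquiv.ofBijective j.hom hj).symm (j.hom a) = a :=
          (AlgEquiv.ofBijective j.hom hj).symm_apply_apply a
        change (AlgEquiv.ofBijective j.hom hj).symm (j.hom a) ∈ A.part i
        rw [h1]
        obtain ⟨x, hx, y, hy, rfl⟩ := exists_add_of_parity i a
        have h2 : j.hom y ∈ B.part i := by
          rw [map_add] at hs
          rw [← add_sub_cancel_left (j.hom x) (j.hom y)]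
          exact sub_mem hs (j.map_part i x hx)
        -- The inverse preserves parity: the component of the wrong parity maps to an element of
        -- both parities, so injectivity kills it.
        have h3 : y = 0 := hj.1 <| by
          rw [eq_zero_of_mem_of_mem_add_one h2 (j.map_part _ y hy), map_zero]
        rwa [h3, add_zero] }
  hom_inv_id := Hom.ext (AlgHom.ext fun a => (AlgEquiv.ofBijective j.hom hj).symm_apply_apply a)
  inv_hom_id := Hom.ext (AlgHom.ext fun a => (AlgEquiv.ofBijective j.hom hj).apply_symm_apply a)

/-- A superalgebra is the superalgebra of global sections of `SSpec A`. -/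
noncomputable def toOpenTopIso (A : SAlg.{w, u} k) : A ≅ A.sections ⊤ :=
  isoOfBijective (A.toOpen ⊤) (StructureSheaf.toOpenₗ_top_bijective (R := A.even) (M := A))

end SAlg

namespace SuperSpace

variable {k : Type w} [Field k] {X : SuperSpace.{w, u} k} {U V : Opens X.carrier}
  {A B : SAlg.{w, u} k}

namespace Chart

variable (φ : Chart X U A)

/-- The superalgebra of sections over an affine open subset isomorphic to `SSpec A` is `A`. -/
noncomputable def globalIso : A ≅ X.sections U :=
  A.toOpenTopIso ≪≫ φ.sectionsIso ⊤ ≪≫ eqToIso (by rw [φ.opens_top])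

theorem isAway_toSections (f : A.even) :
    SAlg.IsAway f (φ.toSections (PrimeSpectrum.basicOpen f)) :=
  (SAlg.isAway_toOpen f).comp_iso _

theorem notMem_of_isUnit {W : Opens (PrimeSpectrum A.even)} {f : A.even}
    (h : IsUnit ((φ.toSections W).hom (f : A))) {p : PrimeSpectrum A.even} (hp : p ∈ W) :
    f ∉ p.asIdeal := by
  refine SAlg.notMem_of_isUnit_toOpen (W := W) ?_ hp
  have h1 := h.map (φ.sectionsIso W).inv.hom
  have h2 : (φ.sectionsIso W).inv.hom ((φ.toSections W).hom (f : A)) = (A.toOpen W).hom (f : A) :=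
    congrArg (fun g : A.sections W ⟶ A.sections W => g.hom ((A.toOpen W).hom (f : A)))
      (φ.sectionsIso W).hom_inv_id
  rwa [h2] at h1

theorem exists_mul_eq_zero {W : Opens (PrimeSpectrum A.even)} {a : A}
    (h : (φ.toSections W).hom a = 0) {p : PrimeSpectrum A.even} (hp : p ∈ W) :
    ∃ c : A.even, c ∉ p.asIdeal ∧ (c : A) * a = 0 := by
  have h2 : (φ.sectionsIso W).inv.hom ((φ.toSections W).hom a) = (A.toOpen W).hom a :=
    congrArg (fun g : A.sections W ⟶ A.sections W => g.hom ((A.toOpen W).hom a))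
      (φ.sectionsIso W).hom_inv_id
  rw [h, map_zero] at h2
  exact SAlg.mk_one_eq_zero.mp (congrArg (fun s : A.Sections W => s.1 ⟨p, hp⟩) h2.symm)

theorem exists_basicOpen_le {x : X.carrier} (hU : x ∈ U) (hV : x ∈ V) :
    ∃ f : A.even, x ∈ φ.opens (PrimeSpectrum.basicOpen f) ∧
      φ.opens (PrimeSpectrum.basicOpen f) ≤ V := by
  let S : Set (PrimeSpectrum A.even) := φ.pt '' (Subtype.val ⁻¹' (V : Set X.carrier))
  have hS : IsOpen S := φ.pt.isOpenMap _ (V.2.preimage continuous_subtype_val)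
  obtain ⟨_, ⟨_, ⟨f, rfl⟩, rfl⟩, hxf, hfS⟩ :=
    PrimeSpectrum.isBasis_basic_opens.exists_subset_of_mem_open
      (show φ.pt ⟨x, hU⟩ ∈ S from ⟨⟨x, hU⟩, hV, rfl⟩) hS
  refine ⟨f, φ.mem_opens.mpr ⟨hU, hxf⟩, fun y hy => ?_⟩
  obtain ⟨hyU, hy⟩ := φ.mem_opens.mp hy
  obtain ⟨z, hz, hzy⟩ := hfS hy
  rw [φ.pt.injective hzy] at hz
  exact hz

/-- An even function invertible on `W` lies in no prime of `W`. This lets inclusions into basic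
opens be proved by checking units, even when `W` comes from another chart. -/
theorem mem_basicOpen_of_isUnit_res {W : Opens X.carrier} {Z : Opens (PrimeSpectrum A.even)}
    (h : W ≤ φ.opens Z) {f : A.even} (hf : IsUnit ((X.res h).hom ((φ.toSections Z).hom (f : A)))) :
    W ≤ φ.opens (PrimeSpectrum.basicOpen f) := by
  intro x hx
  obtain ⟨hxU, -⟩ := φ.mem_opens.mp (h hx)
  obtain ⟨g, hxg, hg⟩ := φ.exists_basicOpen_le hxU hx
  have hgZ : PrimeSpectrum.basicOpen g ≤ Z := fun p hp => by
    obtain ⟨y, rfl⟩ := φ.pt.surjective p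
    exact (φ.mem_opens.mp (h (hg (φ.mem_opens.mpr ⟨y.2, hp⟩)))).2
  have h1 := hf.map (X.res hg).hom
  rw [res_res, φ.res_toSections hgZ] at h1
  obtain ⟨_, hxg⟩ := φ.mem_opens.mp hxg
  exact φ.mem_opens.mpr ⟨hxU, φ.notMem_of_isUnit h1 hxg⟩

/-- A point of two affine open subsets has a neighbourhood which is a basic open subset of both. -/
theorem exists_basicOpen_eq (φ : Chart X U A) (ψ : Chart X V B) {x : X.carrier} (hU : x ∈ U)
    (hV : x ∈ V) : ∃ (f : A.even) (g : B.even), x ∈ φ.opens (PrimeSpectrum.basicOpen f) ∧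
      φ.opens (PrimeSpectrum.basicOpen f) = ψ.opens (PrimeSpectrum.basicOpen g) := by
  obtain ⟨f, hxf, hf⟩ := φ.exists_basicOpen_le hU hV
  obtain ⟨g, hxg, hg⟩ := ψ.exists_basicOpen_le hV hxf
  let W := φ.opens (PrimeSpectrum.basicOpen f)
  have hW : W ≤ ψ.opens ⊤ := hf.trans ψ.opens_top.ge
  let s : X.sections W := (X.res hW).hom ((ψ.toSections ⊤).hom (g : B))
  have hs : s ∈ (X.sections W).part 0 := (X.res hW).map_part 0 _ ((ψ.toSections ⊤).map_part 0 _ g.2)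
  -- On `D(f)` the function `g` equals `a / f ^ n` with `a` even. So `D(g)`, which lies inside
  -- `D(f)`, is the locus `D(f * a)` where both `f` and `a` are invertible.
  obtain ⟨a, ha, n, hn⟩ := (φ.isAway_toSections f).exists_eq 0 s hs
  let a' : A.even := ⟨a, ha⟩
  have hD : PrimeSpectrum.basicOpen (f * a') ≤ PrimeSpectrum.basicOpen f :=
    PrimeSpectrum.basicOpen_mul_le_left f a'
  have hf' := (φ.isAway_toSections f).isUnit
  have heq : φ.opens (PrimeSpectrum.basicOpen (f * a')) = ψ.opens (PrimeSpectrum.basicOpen g) := by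
    refine le_antisymm (ψ.mem_basicOpen_of_isUnit_res ((φ.opens_mono hD).trans hW) ?_)
      (φ.mem_basicOpen_of_isUnit_res hg ?_)
    · rw [← res_res (φ.opens_mono hD) hW]
      have h1 := (φ.isAway_toSections (f * a')).isUnit
      rw [MulMemClass.coe_mul, map_mul, ← φ.res_toSections hD, ← φ.res_toSections hD, hn, map_mul,
        map_pow] at h1
      have h2 := hf'.map (X.res (φ.opens_mono hD)).hom
      exact (h2.pow n).mul_left_iff.mp (h2.mul_left_iff.mp h1)
    · rw [MulMemClass.coe_mul, map_mul, map_mul, hn, map_mul, map_pow]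
      have h2 := hf'.map (X.res hg).hom
      refine h2.mul ((h2.pow n).mul ?_)
      rw [res_res, ψ.res_toSections le_top]
      exact (ψ.isAway_toSections g).isUnit
  exact ⟨f * a', g, heq ▸ hxg, heq⟩

end Chart

end SuperSpace

/-! ### Comparison of super-dimensions of different affine opens. -/

namespace SAlg

variable {k : Type w} [Field k] {C : SAlg.{w, u} k}

theorem exists_prod_ofFn_eq {c : C} (hc : c ∈ C.part 0) {m : ℕ} {n : Fin m → ℕ} {s t : Fin m → C}
    (h : ∀ i, t i = c ^ n i * s i) :
    ∃ N : ℕ, (List.ofFn t).prod = c ^ N * (List.ofFn s).prod := by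
  induction m with
  | zero => exact ⟨0, by simp⟩
  | succ m ih =>
    obtain ⟨N, hN⟩ := ih (n := fun i => n i.succ) (s := fun i => s i.succ) (t := fun i => t i.succ)
      fun i => h i.succ
    refine ⟨n 0 + N, ?_⟩
    have hcomm : s 0 * c ^ N = c ^ N * s 0 :=
      (Commute.pow_left (C.comm_of_even hc (s 0) : Commute c (s 0)) N).eq.symm
    rw [List.ofFn_succ, List.ofFn_succ, List.prod_cons, List.prod_cons, hN, h 0, pow_add, mul_assoc,
      mul_assoc, ← mul_assoc (s 0), hcomm, mul_assoc]

/-- This is where the lexicographic order enters: the transported chain bounds the first coordinate,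
and it is a longest chain of `B`, making `z` a system of odd parameters, exactly when the first
coordinates agree. -/
theorem le_of_hasKsdim {A B : SAlg.{w, u} k} {p q : ℕ ×ₗ ℕ} (hp : A.HasKsdim p)
    (hq : B.HasKsdim q)
    {c : LTSeries (PrimeSpectrum A.even)}
    (hc : (c.length : WithBot ℕ∞) = ringKrullDim A.even)
    (h : ∃ (z : Fin (ofLex p).2 → B) (b : LTSeries (PrimeSpectrum B.even)),
      (∀ i, z i ∈ B.part 1) ∧ b.length = c.length ∧
        Ideal.torsionOf B.even B (List.ofFn z).prod ≤ b.head.asIdeal) :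
    p ≤ q := by
  obtain ⟨z, b, hz, hb, hAnn'⟩ := h
  have h1 : c.length = (ofLex p).1 := by exact_mod_cast hc.trans hp.1
  have h2 : (b.length : WithBot ℕ∞) ≤ (ofLex q).1 :=
    (Order.LTSeries.length_le_krullDim b).trans hq.1.le
  have h3 : (ofLex p).1 ≤ (ofLex q).1 := by
    rw [hb, h1] at h2
    exact_mod_cast h2
  refine Prod.Lex.le_iff.mpr (h3.lt_or_eq.imp_right fun h4 => ⟨h4, hq.2.2 ⟨z, hz, b, ?_, hAnn'⟩⟩)
  rw [hb, h1, h4]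
  exact hq.1.symm

end SAlg

namespace SuperSpace

variable {k : Type w} [Field k] {X : SuperSpace.{w, u} k} {U V : Opens X.carrier}
  {A B : SAlg.{w, u} k}

namespace Chart

/-- If the `f` with Noetherian localization lay in a maximal ideal, its point would have a basic
neighbourhood `D(f)` that is also basic in a Noetherian chart, so such an `f` would avoid that
ideal. -/
theorem isNoetherian (φ : Chart X U A) (hX : X.IsNoetherian) : A.IsNoetherian := by
  refine SAlg.isNoetherian_of_span (S := {f | ∃ (C : SAlg.{w, u} k) (j : A ⟶ C),
    SAlg.IsAway f j ∧ C.IsNoetherian}) ?_ fun f hf => hf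
  by_contra h
  obtain ⟨m, hm, hle⟩ := Ideal.exists_le_maximal _ h
  obtain ⟨x, hx⟩ := φ.pt.surjective ⟨m, hm.isPrime⟩
  obtain ⟨T, -, hT, hTN⟩ := hX
  obtain ⟨V, hVT, hxV⟩ := Opens.mem_sSup.mp (hT ▸ Opens.mem_top x.1)
  obtain ⟨B, hB, ⟨(ψ : Chart X V B)⟩⟩ := hTN V hVT
  obtain ⟨f, g, hxf, hfg⟩ := exists_basicOpen_eq φ ψ x.2 hxV
  obtain ⟨_, hxf⟩ := φ.mem_opens.mp hxf
  refine hxf (?_ : f ∈ (φ.pt x).asIdeal)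
  rw [hx]
  refine hle (Ideal.subset_span ⟨_, _, φ.isAway_toSections f, ?_⟩)
  rw [hfg]
  exact (ψ.isAway_toSections g).isNoetherian hB

theorem ringKrullDim_le (φ : Chart X U A) : ringKrullDim A.even ≤ X.dimRes := by
  rw [← PrimeSpectrum.topologicalKrullDim_eq_ringKrullDim,
    ← IsHomeomorph.topologicalKrullDim_eq _ φ.pt.isHomeomorph]
  exact topologicalKrullDim_subspace_le X.carrier U

theorem exists_ringKrullDim_eq (φ : Chart X U A) (hU : U ≠ ⊥) (hX : X.dimRes < ⊤) :
    ∃ d : ℕ, ringKrullDim A.even = d := by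
  obtain ⟨x, hx⟩ := (Opens.ne_bot_iff_nonempty U).mp hU
  have : Nonempty (PrimeSpectrum A.even) := ⟨φ.pt ⟨x, hx⟩⟩
  have := PrimeSpectrum.nonempty_iff_nontrivial.mp this
  have h0 : (0 : WithBot ℕ∞) ≤ ringKrullDim A.even := ringKrullDim_nonneg_of_nontrivial
  have h1 := φ.ringKrullDim_le.trans_lt hX
  revert h0 h1
  generalize ringKrullDim A.even = r
  intro h0 h1
  induction r using WithBot.recBotCoe with
  | bot => simp at h0
  | coe r =>
    induction r using ENat.recTopCoe with
    | top => exact absurd h1 (lt_irrefl _)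
    | coe d => exact ⟨d, rfl⟩

/-- Prime chains and odd elements can be moved from one affine open subset to another one which
contains the closed end of the chain. -/
theorem exists_ltSeries (φ : Chart X U A) (ψ : Chart X V B) {n : ℕ} {y : Fin n → A}
    (hy : ∀ i, y i ∈ A.part 1) (c : LTSeries (PrimeSpectrum A.even))
    (hc : Ideal.torsionOf A.even A (List.ofFn y).prod ≤ c.head.asIdeal)
    (hV : (φ.pt.symm c.last).1 ∈ V) :
    ∃ (z : Fin n → B) (b : LTSeries (PrimeSpectrum B.even)), (∀ i, z i ∈ B.part 1) ∧
      b.length = c.length ∧ Ideal.torsionOf B.even B (List.ofFn z).prod ≤ b.head.asIdeal := by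
  obtain ⟨g, hxg, hg⟩ := ψ.exists_basicOpen_le hV (φ.pt.symm c.last).2
  have hW := hg.trans φ.opens_top.ge
  let r : A ⟶ X.sections (ψ.opens (PrimeSpectrum.basicOpen g)) := φ.toSections ⊤ ≫ X.res hW
  -- Clearing denominators: `zᵢ` restricts to `g ^ mᵢ * yᵢ` on `D(g)`, with `g` a unit there.
  choose z hz m hm using fun i =>
    (ψ.isAway_toSections g).exists_eq 1 _ (r.map_part 1 _ (hy i))
  have hsp : ∀ i j, i ≤ j → (φ.pt.symm (c i)).1 ⤳ (φ.pt.symm (c j)).1 := fun i j hij =>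
    ((PrimeSpectrum.le_iff_specializes _ _).mp (c.monotone hij)).map
      (continuous_subtype_val.comp φ.pt.symm.continuous)
  have hmem : ∀ i, (φ.pt.symm (c i)).1 ∈ ψ.opens (PrimeSpectrum.basicOpen g) := fun i =>
    (hsp i (Fin.last _) (Fin.le_last i)).mem_open (Opens.isOpen _) hxg
  have hmV : ∀ i, (φ.pt.symm (c i)).1 ∈ V := fun i => ψ.opens_le _ (hmem i)
  let b : LTSeries (PrimeSpectrum B.even) := LTSeries.mk c.length
    (fun i => ψ.pt ⟨(φ.pt.symm (c i)).1, hmV i⟩) (Monotone.strictMono_of_injective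
      (fun i j hij => (PrimeSpectrum.le_iff_specializes _ _).mpr
        ((Topology.IsInducing.subtypeVal.specializes_iff.mp (hsp i j hij) :
          (⟨_, hmV i⟩ : V) ⤳ ⟨_, hmV j⟩).map ψ.pt.continuous))
      (fun i j hij => c.strictMono.injective (φ.pt.symm.injective
        (Subtype.ext (congrArg (fun v : V => v.1) (ψ.pt.injective hij))))))
  refine ⟨z, b, hz, rfl, fun a ha => ?_⟩
  by_contra hab
  have hab' : a ∉ (ψ.pt ⟨(φ.pt.symm c.head).1, hmV 0⟩).asIdeal := hab
  let D := PrimeSpectrum.basicOpen g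
  -- If `a` kills the product of the `zᵢ` but is outside the head prime, then `D(g * a)` is a
  -- neighbourhood of that point on which `g` and `a` are units, so the product of the `yᵢ` vanishes
  -- there.
  have hD : PrimeSpectrum.basicOpen (g * a) ≤ D := PrimeSpectrum.basicOpen_mul_le_left g a
  have hx0 : (φ.pt.symm c.head).1 ∈ ψ.opens (PrimeSpectrum.basicOpen (g * a)) := by
    refine ψ.mem_opens.mpr ⟨hmV 0, fun h => ?_⟩
    obtain ⟨_, h0⟩ := ψ.mem_opens.mp (hmem 0)
    exact ((ψ.pt _).isPrime.mem_or_mem h).elim h0 hab'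
  obtain ⟨f, hxf, hf⟩ := φ.exists_basicOpen_le (φ.pt.symm c.head).2 hx0
  obtain ⟨N, hN⟩ := SAlg.exists_prod_ofFn_eq ((ψ.toSections D).map_part 0 _ g.2) hm
  have h1 : (a : B) * (List.ofFn z).prod = 0 := (Ideal.mem_torsionOf_iff _ _).mp ha
  have h2 : (ψ.toSections D).hom (a : B) * ((ψ.toSections D).hom (g : B) ^ N *
      r.hom (List.ofFn y).prod) = 0 := by
    rw [map_list_prod, List.map_ofFn]
    refine (congrArg (_ * ·) hN.symm).trans ?_
    have := congrArg (ψ.toSections D).hom h1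
    rwa [map_mul, map_list_prod, List.map_ofFn, map_zero] at this
  have h3 := congrArg (X.res (ψ.opens_mono hD)).hom h2
  have hu := (ψ.isAway_toSections (g * a)).isUnit
  rw [MulMemClass.coe_mul, map_mul] at hu
  have hcomm : Commute ((ψ.toSections (PrimeSpectrum.basicOpen (g * a))).hom (g : B))
      ((ψ.toSections (PrimeSpectrum.basicOpen (g * a))).hom (a : B)) :=
    SAlg.comm_of_even _ ((ψ.toSections _).map_part 0 _ g.2) _
  obtain ⟨hug, hua⟩ := hcomm.isUnit_mul_iff.mp hu
  rw [map_mul, map_mul, map_pow, map_zero, ψ.res_toSections hD, ψ.res_toSections hD,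
    hua.mul_right_eq_zero, (hug.pow N).mul_right_eq_zero] at h3
  have h4 := congrArg (X.res hf).hom h3
  have h5 : (φ.toSections (PrimeSpectrum.basicOpen f)).hom (List.ofFn y).prod = 0 := by
    have : r.hom (List.ofFn y).prod =
      (X.res hW).hom ((φ.toSections ⊤).hom (List.ofFn y).prod) := rfl
    rwa [this, res_res, res_res, φ.res_toSections le_top, map_zero] at h4
  obtain ⟨_, hxf⟩ := φ.mem_opens.mp hxf
  -- Zero germ at the head prime: some `e` outside that prime kills the product of the `yᵢ`, against
  -- the hypothesis on its annihilator.
  obtain ⟨e, he, he0⟩ := φ.exists_mul_eq_zero h5 hxf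
  refine he ?_
  rw [Subtype.coe_eta, Homeomorph.apply_symm_apply]
  exact hc ((Ideal.mem_torsionOf_iff _ _).mpr he0)

end Chart

/-- The Krull super-dimension of an affine open subset is at most that of some member of a given
affine covering. -/
theorem IsAffineCovering.exists_hasKsdim_le {S : Set (Opens X.carrier)} (hS : X.IsAffineCovering S)
    (hex : ∀ U ∈ S, ∃ q, (X.sections U).HasKsdim q) (hU : X.IsAffineOpen U) {p : ℕ ×ₗ ℕ}
    (hp : (X.sections U).HasKsdim p) : ∃ V ∈ S, ∃ q, (X.sections V).HasKsdim q ∧ p ≤ q := by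
  obtain ⟨A, ⟨(φ : Chart X U A)⟩⟩ := hU
  have hpA := hp.of_iso φ.globalIso.symm
  obtain ⟨y, hy, c, hc, hAnn⟩ := hpA.2.1
  obtain ⟨V, hVS, hxV⟩ := Opens.mem_sSup.mp (hS.1 ▸ Opens.mem_top (φ.pt.symm c.last).1)
  obtain ⟨q, hq⟩ := hex V hVS
  obtain ⟨B, ⟨(ψ : Chart X V B)⟩⟩ := (hS.2 V hVS).2
  refine ⟨V, hVS, q, hq, ?_⟩
  exact SAlg.le_of_hasKsdim hpA (hq.of_iso ψ.globalIso.symm) hc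
    (φ.exists_ltSeries ψ hy c hAnn hxV)

theorem exists_hasKsdim (hk : ringChar k ≠ 2) (hN : X.IsNoetherian) (hdim : X.dimRes < ⊤)
    (hU : U ≠ ⊥) (hUa : X.IsAffineOpen U) : ∃ q, (X.sections U).HasKsdim q := by
  obtain ⟨A, ⟨(φ : Chart X U A)⟩⟩ := hUa
  obtain ⟨d, hd⟩ := φ.exists_ringKrullDim_eq hU hdim
  obtain ⟨q, hq⟩ := SAlg.exists_hasKsdim hk (φ.isNoetherian hN) hd
  exact ⟨q, hq.of_iso φ.globalIso⟩

theorem IsNoetherian.exists_finite_isAffineCovering (hN : X.IsNoetherian) :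
    ∃ S : Set (Opens X.carrier), S.Finite ∧ X.IsAffineCovering S := by
  obtain ⟨T, hT, hTt, hTN⟩ := hN
  refine ⟨T \ {⊥}, hT.sdiff, ?_, fun U hU => ⟨hU.2, ?_⟩⟩
  · rw [sSup_sdiff_singleton_bot, hTt]
  · obtain ⟨B, -, h⟩ := hTN U hU.1
    exact ⟨B, h⟩

/-- The upper bounds of the Krull super-dimensions do not depend on the affine covering. -/
theorem IsAffineCovering.isSdim_congr {S T : Set (Opens X.carrier)} (hS : X.IsAffineCovering S)
    (hT : X.IsAffineCovering T)
    (hex : ∀ U, U ≠ ⊥ → X.IsAffineOpen U → ∃ q, (X.sections U).HasKsdim q) {p : ℕ ×ₗ ℕ}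
    (hp : X.IsSdim S p) : X.IsSdim T p := by
  have key : ∀ {S T : Set (Opens X.carrier)}, X.IsAffineCovering S → X.IsAffineCovering T →
      upperBounds {q | ∃ U ∈ S, (X.sections U).HasKsdim q} ⊆
        upperBounds {q | ∃ U ∈ T, (X.sections U).HasKsdim q} := by
    rintro S T hS hT p hp q ⟨U, hU, hq⟩
    obtain ⟨V, hV, q', hq', hle⟩ := hS.exists_hasKsdim_le
      (fun V hV => hex V (hS.2 V hV).1 (hS.2 V hV).2) (hT.2 U hU).2 hq
    exact hle.trans (hp ⟨V, hV, hq'⟩)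
  unfold IsSdim IsLUB at hp ⊢
  rwa [(key hT hS).antisymm (key hS hT)]

end SuperSpace

theorem mainTheorem8 {k : Type w} [Field k] (hk : ringChar k ≠ 2) (X : SuperSpace.{w, u} k)
    (hX : X.IsSuperscheme) (hN : X.IsNoetherian) (hdim : X.dimRes < ⊤) :
    (∀ U : Opens X.carrier, U ≠ ⊥ → X.IsAffineOpen U →
      (X.sections U).IsNoetherian ∧ ∃! q : ℕ ×ₗ ℕ, (X.sections U).HasKsdim q) ∧
    ∃! p : ℕ ×ₗ ℕ, ∀ S : Set (Opens X.carrier), X.IsAffineCovering S → X.IsSdim S p := by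
  have hex := fun (U : Opens X.carrier) (hU : U ≠ ⊥) (hUa : X.IsAffineOpen U) =>
    SuperSpace.exists_hasKsdim hk hN hdim hU hUa
  refine ⟨fun U hU hUa => ⟨?_, ?_⟩, ?_⟩
  · obtain ⟨A, ⟨(φ : SuperSpace.Chart X U A)⟩⟩ := hUa
    exact (SAlg.isAway_of_iso φ.globalIso).isNoetherian (φ.isNoetherian hN)
  · obtain ⟨q, hq⟩ := hex U hU hUa
    exact ⟨q, hq, fun q' hq' => hq'.unique hq⟩
  · obtain ⟨S, hSf, hS⟩ := hN.exists_finite_isAffineCovering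
    have hfin : {q : ℕ ×ₗ ℕ | ∃ U ∈ S, (X.sections U).HasKsdim q}.Finite := by
      have : {q : ℕ ×ₗ ℕ | ∃ U ∈ S, (X.sections U).HasKsdim q} =
          ⋃ U ∈ S, {q | (X.sections U).HasKsdim q} := by
        ext q
        simp
      rw [this]
      refine hSf.biUnion fun U _ => Set.Subsingleton.finite fun q hq q' hq' => hq.unique hq'
    -- When `X` is empty the set of values is empty and this supremum is the least pair `(0, 0)`.
    have hlub : X.IsSdim S (hfin.toFinset.sup id) := by
      have := Finset.isLUB_sup_id (s := hfin.toFinset)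
      rwa [Set.Finite.coe_toFinset] at this
    exact ⟨_, fun T hT => hS.isSdim_congr hT hex hlub, fun p hp => (hp S hS).unique hlub⟩
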